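/- **Definitions.** Let $m\ge 1$, let $e_1,\dots,e_m$ be the standard basis of $\mathbb{R}^m$, and let $\mathrm{rk}(x)=\sum_i x_i$. A *polytope* $P\subset\mathbb{R}^m$ is a non-empty finite union of convex hulls of finite sets (not necessarily convex); it has dimension $m$ if its interior is non-empty. The *rank* of $P$ is $\max_P \mathrm{rk}+\min_P\mathrm{rk}$. A *partial simplex* is a simplex with some relatively open faces removed that still contains the relative interior of the simplex. A *swipe* $S$ in direction $e_i$ consists of two partial simplices $S^s$ and $S^e$ (its starting and ending turning sets), not parallel to $e_i$, whose points correspond bijectively via translation by non-negative multiples of $e_i$ (vertices corresponding to vertices and removed faces to removed faces); as a set, $S$ is the union of the closed segments joining corresponding points, and it is required to be convex. Swipes $S_0,\dots,S_k$ are *compatible* if $S_i^e=S_{i+1}^s$ for $0\le i<k$. A *real snake* is the union of a compatible sequence $S_0,\dots,S_k$ such that, whenever $i<j$ and $x\in S_i\cap S_j$, one has $x\in S_i^e$, $x\in S_j^s$, and $x\in S_l^s\cap S_l^e$ for all $i<l<j$. A point $x\in S_i$ is *$i$-halted* if either $x\in S_i^s$ and $x\in S_l^s\cap S_l^e$ for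 all $l<i$, or $x\in S_i^e$ and $x\in S_l^s\cap S_l^e$ for all $l>i$. With $T_i=S_i\setminus\{i\text{-halted points}\}$, a *fake snake* is the union of the $T_i$, for a compatible sequence such that, whenever $i<j$ and $x\in T_i\cap T_j$, one has $x\in S_i^e$, $x\in S_j^s$, and $x\in T_l\cap S_l^s\cap S_l^e$ for all $i<l<j$. A snake is *symmetric* in $P$ if the ranks of any vertex of $\overline{S_0^s}$ and of the corresponding vertex of $\overline{S_k^e}$ add up to the rank of $P$. An *asymptotic geometric symmetric chain decomposition* of a polytope $P\subset\mathbb{R}^m$ of dimension $m$ is a finite family of pairwise disjoint symmetric (real or fake) snakes contained in $P$, each of dimension $m$, such that the set of points of $P$ lying in no snake has codimension at least $1$ (is contained in a finite union of proper affine subspaces). It satisfies the *weak hyperplane condition* if for any two consecutive swipes $S_l,S_{l+1}$ of one of its snakes, of directions $e_i$ and $e_j$, the turning set $S_l^e=S_{l+1}^s$ lies in a hyperplane $\sum_c a_cx_c=b$ with $a\neq 0$ and $a_i=a_j$. **Theorem.** Let $P\subset\mathbb{R}^m$ and $Q\subset\mathbb{R}^n$ be polytopes of dimension $m$ and $n$,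 each having an asymptotic geometric symmetric chain decomposition that satisfies the weak hyperplane condition. Then $P\times Q\subset\mathbb{R}^{m+n}$ is a polytope of dimension $m+n$ that has an asymptotic geometric symmetric chain decomposition satisfying the weak hyperplane condition. -/

import Mathlib

namespace GeomSCD

section

variable {ι : Type*} [Fintype ι] [DecidableEq ι]

/-- The rank of a point: the sum of its coordinates. -/
def rk (x : ι → ℝ) : ℝ := ∑ i, x i

/-- The rank of a polytope: maximal plus minimal rank of its points. -/
noncomputable def polytopeRank (P : Set (ι → ℝ)) : ℝ := sSup (rk '' P) + sInf (rk '' P)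

/-- A polytope, not necessarily convex: a finite union of convex hulls of finite sets. -/
def IsPolytope (P : Set (ι → ℝ)) : Prop :=
  P.Nonempty ∧ ∃ C : Finset (Finset (ι → ℝ)), P = ⋃ V ∈ C, convexHull ℝ (V : Set (ι → ℝ))

/-- A polytope whose dimension is that of the ambient space. -/
def IsFullDimPolytope (P : Set (ι → ℝ)) : Prop :=
  IsPolytope P ∧ (interior P).Nonempty

/-- Codimension at least one in the ambient space, in the piecewise linear sense:
the set is covered by finitely many proper affine subspaces. -/
def HasPositiveCodim (A : Set (ι → ℝ)) : Prop :=
  ∃ H : Set (AffineSubspace ℝ (ι → ℝ)), H.Finite ∧ (∀ h ∈ H, h ≠ ⊤) ∧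
    A ⊆ ⋃ h ∈ H, (h : Set (ι → ℝ))

/-- The relative interior of the face with vertices `v j`, `j ∈ A`, of the simplex with
vertices `v`; points are given by barycentric coordinates. -/
def openFace {d : ℕ} (v : Fin (d + 1) → ι → ℝ) (A : Finset (Fin (d + 1))) : Set (ι → ℝ) :=
  {x | ∃ w : Fin (d + 1) → ℝ, (∀ j ∈ A, 0 < w j) ∧ (∀ j, j ∉ A → w j = 0) ∧
    ∑ j, w j = 1 ∧ x = ∑ j, w j • v j}

variable (ι) in
/-- A partial `d`-simplex: a simplex with some relatively open faces removed which still
contains its relative interior. `faces` lists (the vertex sets of) the faces that are kept. -/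
structure PartialSimplex (d : ℕ) where
  vertex : Fin (d + 1) → ι → ℝ
  indep : AffineIndependent ℝ vertex
  faces : Set (Finset (Fin (d + 1)))
  univ_mem : Finset.univ ∈ faces

/-- The points of a partial simplex. -/
def PartialSimplex.carrier {d : ℕ} (S : PartialSimplex ι d) : Set (ι → ℝ) :=
  ⋃ A ∈ S.faces, openFace S.vertex A

/-- The union of all line segments in the direction of the basis vector `e i` that start
in `A` and end in `B`. -/
def sweep (i : ι) (A B : Set (ι → ℝ)) : Set (ι → ℝ) :=
  {z | ∃ p ∈ A, ∃ q ∈ B, (∃ t : ℝ, 0 ≤ t ∧ q = p + t • Pi.single i (1 : ℝ)) ∧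
    z ∈ segment ℝ p q}

variable (ι) in
/-- A swipe in the coordinate direction `dir` from the turning set `start` to the turning set
`finish`. Corresponding vertices carry the same index. As the direction is not parallel to
the turning sets, every point of `start` corresponds to exactly one point of `finish`; see
`Swipe.biject` below. -/
structure Swipe (d : ℕ) where
  dir : ι
  start : PartialSimplex ι d
  finish : PartialSimplex ι d
  transverse : Pi.single dir (1 : ℝ) ∉ vectorSpan ℝ (Set.range start.vertex)
  translate : ∀ j, ∃ t : ℝ, 0 ≤ t ∧
    finish.vertex j = start.vertex j + t • Pi.single dir (1 : ℝ)
  faces_eq : finish.faces = start.faces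
  convex : Convex ℝ (sweep dir start.carrier finish.carrier)

/-- The points of a swipe. -/
def Swipe.carrier {d : ℕ} (S : Swipe ι d) : Set (ι → ℝ) :=
  sweep S.dir S.start.carrier S.finish.carrier

/-- The swipe identifies the points of its two turning sets: each point of one is joined to
exactly one point of the other by a nonnegative translation in the direction of the swipe. -/
theorem Swipe.biject {d : ℕ} (S : Swipe ι d) :
    (∀ p ∈ S.start.carrier, ∃! q, q ∈ S.finish.carrier ∧
      ∃ t : ℝ, 0 ≤ t ∧ q = p + t • Pi.single S.dir (1 : ℝ)) ∧
    (∀ q ∈ S.finish.carrier, ∃! p, p ∈ S.start.carrier ∧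
      ∃ t : ℝ, 0 ≤ t ∧ q = p + t • Pi.single S.dir (1 : ℝ)) := by
  choose t ht hv using S.translate
  set e : ι → ℝ := Pi.single S.dir (1 : ℝ) with he
  have hsum : ∀ w : Fin (d + 1) → ℝ,
      ∑ j, w j • S.finish.vertex j = ∑ j, w j • S.start.vertex j + (∑ j, w j * t j) • e := by
    intro w
    simp only [hv, smul_add, Finset.sum_add_distrib, Finset.sum_smul, smul_smul]
  have hpos : ∀ (A : Finset (Fin (d + 1))) (w : Fin (d + 1) → ℝ), (∀ j ∈ A, 0 < w j) →
      (∀ j, j ∉ A → w j = 0) → 0 ≤ ∑ j, w j * t j := by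
    intro A w h1 h2
    refine Finset.sum_nonneg fun j _ => ?_
    by_cases hj : j ∈ A
    · exact mul_nonneg (h1 j hj).le (ht j)
    · simp [h2 j hj]
  have key : ∀ (w w' : Fin (d + 1) → ℝ) (c : ℝ), ∑ j, w j = 1 → ∑ j, w' j = 1 →
      ∑ j, w' j • S.start.vertex j = ∑ j, w j • S.start.vertex j + c • e → w' = w := by
    intro w w' c h1 h2 h
    have h0 : ∑ j, (w' - w) j = 0 := by simp [Finset.sum_sub_distrib, h1, h2]
    have h3 : ∑ j, (w' - w) j • S.start.vertex j = c • e := by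
      simp only [Pi.sub_apply, sub_smul, Finset.sum_sub_distrib, h, add_sub_cancel_left]
    have hmem : c • e ∈ vectorSpan ℝ (Set.range S.start.vertex) := by
      rw [← h3, ← Finset.weightedVSub_eq_linear_combination Finset.univ (w := w' - w) (p := S.start.vertex) h0]
      exact weightedVSub_mem_vectorSpan h0 _
    have hc : c = 0 := by
      by_contra hc
      exact S.transverse ((Submodule.smul_mem_iff _ hc).1 hmem)
    have h4 := (affineIndependent_iff.1 S.start.indep) Finset.univ (w' - w) h0
      (by rw [h3, hc, zero_smul])
    funext j
    have := h4 j (Finset.mem_univ j)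
    simpa [sub_eq_zero] using this
  constructor
  · intro p hp
    simp only [PartialSimplex.carrier, Set.mem_iUnion] at hp
    obtain ⟨A, hA, w, w1, w2, w3, rfl⟩ := hp
    refine ⟨∑ j, w j • S.finish.vertex j, ⟨?_, _, hpos A w w1 w2, hsum w⟩, ?_⟩
    · simp only [PartialSimplex.carrier, Set.mem_iUnion]
      exact ⟨A, S.faces_eq ▸ hA, w, w1, w2, w3, rfl⟩
    · rintro q ⟨hq, s, -, hs⟩
      simp only [PartialSimplex.carrier, Set.mem_iUnion] at hq
      obtain ⟨A', -, w', -, -, w3', rfl⟩ := hq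
      rw [hsum] at hs
      rw [key w w' (s - ∑ j, w' j * t j) w3 w3' (by rw [sub_smul, ← add_sub_assoc, ← hs]; simp)]
  · intro q hq
    simp only [PartialSimplex.carrier, Set.mem_iUnion] at hq
    obtain ⟨A, hA, w, w1, w2, w3, rfl⟩ := hq
    refine ⟨∑ j, w j • S.start.vertex j, ⟨?_, _, hpos A w w1 w2, hsum w⟩, ?_⟩
    · simp only [PartialSimplex.carrier, Set.mem_iUnion]
      exact ⟨A, S.faces_eq ▸ hA, w, w1, w2, w3, rfl⟩
    · rintro p ⟨hp, s, -, hs⟩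
      simp only [PartialSimplex.carrier, Set.mem_iUnion] at hp
      obtain ⟨A', -, w', -, -, w3', rfl⟩ := hp
      rw [hsum] at hs
      rw [key w w' (∑ j, w j * t j - s) w3 w3' (by rw [sub_smul, ← add_sub_assoc, hs]; simp)]

variable (ι) in
/-- A compatible sequence of swipes `S_0, …, S_k`: the ending turning set of each is the
starting turning set of the next. -/
structure SwipeSeq where
  d : ℕ
  k : ℕ
  swipe : Fin (k + 1) → Swipe ι d
  compatible : ∀ i : Fin k, (swipe i.castSucc).finish = (swipe i.succ).start

namespace SwipeSeq

/-- The non self-intersecting condition for real snakes. -/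
def RealCondition (S : SwipeSeq ι) : Prop :=
  ∀ i j, i < j → ∀ x ∈ (S.swipe i).carrier ∩ (S.swipe j).carrier,
    x ∈ (S.swipe i).finish.carrier ∧ x ∈ (S.swipe j).start.carrier ∧
    ∀ l, i < l → l < j → x ∈ (S.swipe l).start.carrier ∧ x ∈ (S.swipe l).finish.carrier

/-- The point `x` of `S_i` is `i`-halted. -/
def Halted (S : SwipeSeq ι) (i : Fin (S.k + 1)) (x : ι → ℝ) : Prop :=
  ((∀ l, l < i → x ∈ (S.swipe l).start.carrier ∧ x ∈ (S.swipe l).finish.carrier) ∧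
    x ∈ (S.swipe i).start.carrier) ∨
  ((∀ l, i < l → x ∈ (S.swipe l).start.carrier ∧ x ∈ (S.swipe l).finish.carrier) ∧
    x ∈ (S.swipe i).finish.carrier)

/-- `T_i`: the swipe `S_i` without its `i`-halted points. -/
def trimmed (S : SwipeSeq ι) (i : Fin (S.k + 1)) : Set (ι → ℝ) :=
  {x | x ∈ (S.swipe i).carrier ∧ ¬ S.Halted i x}

/-- The non self-intersecting condition for fake snakes. -/
def FakeCondition (S : SwipeSeq ι) : Prop :=
  ∀ i j, i < j → ∀ x ∈ S.trimmed i ∩ S.trimmed j,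
    x ∈ S.trimmed i ∩ (S.swipe i).finish.carrier ∧
    x ∈ S.trimmed j ∩ (S.swipe j).start.carrier ∧
    ∀ l, i < l → l < j → x ∈ S.trimmed l ∩ (S.swipe l).start.carrier ∧
      x ∈ S.trimmed l ∩ (S.swipe l).finish.carrier

end SwipeSeq

variable (ι) in
/-- Real and fake snakes. -/
inductive Snake where
  | real (S : SwipeSeq ι) (h : S.RealCondition)
  | fake (S : SwipeSeq ι) (h : S.FakeCondition)

namespace Snake

/-- The underlying compatible sequence of swipes. -/
def seq : Snake ι → SwipeSeq ι
  | real S _ => S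
  | fake S _ => S

/-- The points of a snake. -/
def carrier : Snake ι → Set (ι → ℝ)
  | real S _ => ⋃ i, (S.swipe i).carrier
  | fake S _ => ⋃ i, S.trimmed i

/-- The snake is symmetric in `P`: the ranks of corresponding vertices of its first and its
last turning set add up to the rank of `P`. -/
def IsSymmetric (F : Snake ι) (P : Set (ι → ℝ)) : Prop :=
  ∀ j, rk ((F.seq.swipe 0).start.vertex j) +
    rk ((F.seq.swipe (Fin.last F.seq.k)).finish.vertex j) = polytopeRank P

/-- Every turning set between two consecutive swipes, of directions `e i` and `e j`, lies in
a hyperplane `∑ a_k x_k = b` with `a_i = a_j`. -/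
def WeakHyperplane (F : Snake ι) : Prop :=
  ∀ l : Fin F.seq.k, ∃ (a : ι → ℝ) (b : ℝ), a ≠ 0 ∧
    (∀ x ∈ (F.seq.swipe l.castSucc).finish.carrier, ∑ c, a c * x c = b) ∧
    a (F.seq.swipe l.castSucc).dir = a (F.seq.swipe l.succ).dir

end Snake

/-- The finite family `F` is an asymptotic geometric symmetric chain decomposition of the
full-dimensional polytope `P`: disjoint full-dimensional symmetric snakes inside `P` that
cover `P` up to a set of codimension at least one. -/
structure IsAsymptoticDecomposition (P : Set (ι → ℝ)) {N : ℕ} (F : Fin N → Snake ι) :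
    Prop where
  subset : ∀ a, (F a).carrier ⊆ P
  fullDim : ∀ a, (interior (F a).carrier).Nonempty
  symmetric : ∀ a, (F a).IsSymmetric P
  disjoint : ∀ a b, a ≠ b → Disjoint (F a).carrier (F b).carrier
  codim : HasPositiveCodim (P \ ⋃ a, (F a).carrier)

/-- `P` has an asymptotic geometric symmetric chain decomposition that satisfies the weak
hyperplane condition. -/
def HasWeakAsymptoticDecomposition (P : Set (ι → ℝ)) : Prop :=
  ∃ (N : ℕ) (F : Fin N → Snake ι),
    IsAsymptoticDecomposition P F ∧ ∀ a, (F a).WeakHyperplane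

end

/-- The product of `P ⊆ ℝ^ι` and `Q ⊆ ℝ^κ`, as a subset of `ℝ^(ι ⊕ κ)`. -/
def prodSet {ι κ : Type*} (P : Set (ι → ℝ)) (Q : Set (κ → ℝ)) : Set (ι ⊕ κ → ℝ) :=
  {z | (fun i => z (Sum.inl i)) ∈ P ∧ (fun j => z (Sum.inr j)) ∈ Q}

end GeomSCD

set_option linter.unusedSectionVars false

/-! A snake is a family of piecewise linear chains, one over each point `z` of a simplex, with
turning points `pt l z` depending affinely on `z` (`ChainBundle`, `exists_realizes`). The conditions
on real and fake snakes both imply that chains over the open simplex meet at most in end points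
(`separates_of_realizes`). Conversely, separated chains of nonnegative step lengths over an open
simplex form a fake snake whose points are exactly those strictly between the ends of their chains
(`iUnion_toSeq_trimmed`, `fakeCondition_toSeq`). Losing end points and boundary faces is harmless,
since the decomposition need only cover up to codimension one.

The product of two chains, of heights `H` and `H'`, is a rectangle, and it splits into L-shaped
chains as in the discrete theorem. For `0 < s < min H H'` the chain starts at heights `(s, 0)`,
climbs in the second factor to `(s, H' - s)`, then moves in the first factor to `(H, H' - s)`. The
rank gained at the start is lost at the end, so symmetry is inherited (`prod_balanced`). A point at
heights `(a, c)` of a chain determines `s = min a (H' - c)`, so the L-shaped chains are separated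
because the factor chains are (`mem_of_prod_mem`, `prod_separates`).

The sequence of swipes along an L depends on the step `i` of the first chain containing height `s`
and the step `j` of the second containing height `H' - s`. Fixing `(i, j)` cuts the parameter space
`E × E' × ℝ` into bounded open cells given by strict affine inequalities. Each cell is, up to
finitely many hyperplane pieces, a finite disjoint union of open simplices
(`dissectable_of_isBounded`), and each simplex yields one fake snake. Generic points of the
rectangle lie on one of these chains (`exists_prod_mem`); the others are the injective affine image
of a negligible set (`negligible_uncovered`).

Turning sets coming from a factor inherit its hyperplane. At the new corner the first height is `s`
and the second is `H' - s`; since the charts of the steps are injective, linear functionals can be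
chosen to read off `s` and `-s` up to constants, with coefficient one in both directions concerned,
and their sum is constant on the corners (`exists_functional`, `prod_weakHyperplane`). Finally all
pairs of snakes are combined. -/

namespace GeomSCD

/-! ### Sets of positive codimension -/

section Negligible

variable {E F : Type*} [AddCommGroup E] [Module ℝ E] [AddCommGroup F] [Module ℝ F]

/-- A set covered by finitely many proper affine subspaces. -/
def Negligible (A : Set E) : Prop :=
  ∃ H : Set (AffineSubspace ℝ E), H.Finite ∧ (∀ h ∈ H, h ≠ ⊤) ∧ A ⊆ ⋃ h ∈ H, (h : Set E)

theorem Negligible.mono {A B : Set E} (hB : Negligible B) (h : A ⊆ B) : Negligible A := by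
  obtain ⟨H, h1, h2, h3⟩ := hB
  exact ⟨H, h1, h2, h.trans h3⟩

theorem Negligible.empty : Negligible (∅ : Set E) :=
  ⟨∅, Set.finite_empty, by simp, by simp⟩

theorem Negligible.biUnion {κ : Type*} {C : Set κ} (hC : C.Finite) {A : κ → Set E}
    (h : ∀ c ∈ C, Negligible (A c)) : Negligible (⋃ c ∈ C, A c) := by
  choose! H h1 h2 h3 using h
  refine ⟨⋃ c ∈ C, H c, hC.biUnion h1, ?_, ?_⟩
  · intro h hh
    simp only [Set.mem_iUnion] at hh
    obtain ⟨c, hc, hh⟩ := hh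
    exact h2 c hc h hh
  · intro x hx
    simp only [Set.mem_iUnion] at hx
    obtain ⟨c, hc, hx⟩ := hx
    have := h3 c hc hx
    simp only [Set.mem_iUnion] at this ⊢
    obtain ⟨h, hh, hx⟩ := this
    exact ⟨h, ⟨c, hc, hh⟩, hx⟩

theorem Negligible.iUnion {κ : Type*} [Finite κ] {A : κ → Set E}
    (h : ∀ c, Negligible (A c)) : Negligible (⋃ c, A c) := by
  simpa using Negligible.biUnion (C := Set.univ) Set.finite_univ (fun c _ => h c)

theorem Negligible.union {A B : Set E} (hA : Negligible A) (hB : Negligible B) :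
    Negligible (A ∪ B) := by
  rw [Set.union_eq_iUnion]
  exact Negligible.iUnion (by rintro (_ | _) <;> assumption)

theorem Negligible.of_subspace {A : Set E} (H : AffineSubspace ℝ E) (hH : H ≠ ⊤)
    (h : A ⊆ H) : Negligible A :=
  ⟨{H}, Set.finite_singleton H, by simpa using hH, by simpa using h⟩

/-- No dimension count is needed: if the image of a subspace were everything, pulling back along the
injective map would show that the subspace was everything already. -/
theorem Negligible.image {A : Set E} (hA : Negligible A) {f : E →ᵃ[ℝ] F}
    (hf : Function.Injective f) : Negligible (f '' A) := by
  obtain ⟨H, h1, h2, h3⟩ := hA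
  refine ⟨(AffineSubspace.map f) '' H, h1.image _, ?_, ?_⟩
  · rintro _ ⟨h, hh, rfl⟩ htop
    apply h2 h hh
    rw [← AffineSubspace.comap_map_eq_of_injective hf h, htop, AffineSubspace.comap_top]
  · rintro _ ⟨x, hx, rfl⟩
    have := h3 hx
    simp only [Set.mem_iUnion] at this ⊢
    obtain ⟨h, hh, hx⟩ := this
    exact ⟨h.map f, ⟨h, hh, rfl⟩, AffineSubspace.mem_map_of_mem f hx⟩

theorem Negligible.preimage {A : Set F} (hA : Negligible A) {f : E →ᵃ[ℝ] F}
    (hf : Function.Surjective f) : Negligible (f ⁻¹' A) := by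
  obtain ⟨H, h1, h2, h3⟩ := hA
  refine ⟨(AffineSubspace.comap f) '' H, h1.image _, ?_, ?_⟩
  · rintro _ ⟨h, hh, rfl⟩ htop
    apply h2 h hh
    refine eq_top_iff.2 fun y _ => ?_
    obtain ⟨x, rfl⟩ := hf y
    have : x ∈ h.comap f := by rw [htop]; exact AffineSubspace.mem_top _ _ _
    exact this
  · intro x hx
    have := h3 hx
    simp only [Set.mem_iUnion] at this ⊢
    obtain ⟨h, hh, hx⟩ := this
    exact ⟨h.comap f, ⟨h, hh, rfl⟩, hx⟩

theorem Negligible.zeros (f : E →ᵃ[ℝ] ℝ) {x : E} (hx : f x ≠ 0) :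
    Negligible {y | f y = 0} := by
  refine Negligible.of_subspace ((AffineSubspace.mk' (0 : ℝ) (⊥ : Submodule ℝ ℝ)).comap f) ?_ ?_
  · intro h
    have : x ∈ (AffineSubspace.mk' (0 : ℝ) (⊥ : Submodule ℝ ℝ)).comap f := by
      rw [h]; exact AffineSubspace.mem_top _ _ _
    rw [AffineSubspace.mem_comap, AffineSubspace.mem_mk'] at this
    simp at this
    exact hx this
  · intro y hy
    simp only [Set.mem_ofPred_eq] at hy
    simp [AffineSubspace.mem_mk', hy]

theorem Negligible.zeros_fst (f : E →ᵃ[ℝ] ℝ) {x : E} (hx : f x ≠ 0) :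
    Negligible {p : E × ℝ | f p.1 = 0} :=
  (Negligible.zeros f hx).preimage (f := (AffineMap.fst : E × ℝ →ᵃ[ℝ] E)) fun y => ⟨(y, 0), rfl⟩

/-- Proper affine subspaces are Lebesgue null, while nonempty open sets have positive measure. -/
theorem Negligible.interior_eq_empty {ι : Type*} [Fintype ι] {A : Set (ι → ℝ)}
    (hA : Negligible A) : interior A = ∅ := by
  obtain ⟨H, h1, h2, h3⟩ := hA
  by_contra hne
  have hpos := isOpen_interior.measure_pos MeasureTheory.volume
    (Set.nonempty_iff_ne_empty.2 hne)
  have h0 : MeasureTheory.volume (⋃ h ∈ H, (h : Set (ι → ℝ))) = 0 :=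
    (MeasureTheory.measure_biUnion_null_iff h1.countable).2 fun h hh =>
      MeasureTheory.Measure.addHaar_affineSubspace _ h (h2 h hh)
  exact hpos.ne' (MeasureTheory.measure_mono_null (interior_subset.trans h3) h0)

end Negligible

/-! ### Dissection of bounded open polyhedra into open simplices -/

section Dissection

variable {σ E : Type*} [Fintype σ] [DecidableEq σ] [NormedAddCommGroup E] [NormedSpace ℝ E]

/-- The open simplex spanned by an affine basis. -/
def openSimplex (b : AffineBasis σ ℝ E) : Set E := {x | ∀ i, 0 < b.coord i x}

theorem affineMap_eq_sum {F : Type*} [AddCommGroup F] [Module ℝ F] (b : AffineBasis σ ℝ E)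
    (f : E →ᵃ[ℝ] F) (x : E) :
    f x = ∑ i, b.coord i x • f (b i) := by
  have h := Finset.univ.map_affineCombination b (fun i => b.coord i x)
    (b.sum_coord_apply_eq_one x) f
  rw [b.affineCombination_coord_eq_self] at h
  rw [h, Finset.affineCombination_eq_linear_combination _ _ _ (b.sum_coord_apply_eq_one x)]
  rfl

/-- Replacing the vertex `j` by an inner point of the edge from `j` to `l`. -/
theorem exists_edge_bisection (b : AffineBasis σ ℝ E) {j l : σ} (hjl : j ≠ l) {c : ℝ}
    (hc0 : 0 < c) (hc1 : c < 1) :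
    ∃ b' : AffineBasis σ ℝ E,
      (∀ i, i ≠ j → b' i = b i) ∧ b' j = AffineMap.lineMap (b j) (b l) c ∧
      openSimplex b' = {x | x ∈ openSimplex b ∧ c * b.coord j x < (1 - c) * b.coord l x} := by
  have : FiniteDimensional ℝ E := b.finiteDimensional
  set u : E := AffineMap.lineMap (b j) (b l) c with hu
  have hcoord : ∀ i, b.coord i u = (1 - c) * b.coord i (b j) + c * b.coord i (b l) := by
    intro i
    rw [hu, AffineMap.apply_lineMap, AffineMap.lineMap_apply_module]
    simp
  have hind : AffineIndependent ℝ (Function.update b j u) := by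
    apply AffineIndependent.affineIndependent_update_of_notMem_affineSpan b.ind
    intro hmem
    have hle : affineSpan ℝ (b '' {x | x ≠ j}) ≤
        (AffineSubspace.mk' (0 : ℝ) (⊥ : Submodule ℝ ℝ)).comap (b.coord j) := by
      rw [affineSpan_le]
      rintro _ ⟨i, hi, rfl⟩
      have hi' : j ≠ i := fun h => hi h.symm
      simp [AffineSubspace.mem_mk', b.coord_apply_ne hi']
    have := hle hmem
    rw [AffineSubspace.mem_comap, AffineSubspace.mem_mk', hcoord] at this
    simp [hjl] at this
    linarith
  let b' : AffineBasis σ ℝ E := ⟨Function.update b j u, hind,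
    (hind.affineSpan_eq_top_iff_card_eq_finrank_add_one).2 b.card_eq_finrank_add_one⟩
  have hb' : ∀ i, b' i = Function.update b j u i := fun _ => rfl
  have hbj : b' j = u := by rw [hb']; simp
  have hbi : ∀ i, i ≠ j → b' i = b i := fun i hi => by rw [hb']; simp [hi]
  -- Evaluating the old coordinates at the new vertices expresses them through the new ones. By `e2`
  -- and `e3`, `(1 - c) * b.coord l - c * b.coord j` equals `(1 - c) * b'.coord l`, so the extra
  -- inequality says that the new `l`-coordinate is positive.
  have e1 : ∀ i x, i ≠ j → i ≠ l → b.coord i x = b'.coord i x := by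
    intro i x hj hl
    rw [affineMap_eq_sum b' (b.coord i) x, Finset.sum_eq_single i]
    · simp [hbi i hj]
    · intro m _ hm
      by_cases h : m = j
      · subst h; rw [hbj, hcoord]; simp [hj, hl]
      · rw [hbi m h]; simp [Ne.symm hm]
    · simp
  have e2 : ∀ x, b.coord j x = (1 - c) * b'.coord j x := by
    intro x
    rw [affineMap_eq_sum b' (b.coord j) x, Finset.sum_eq_single j]
    · rw [hbj, hcoord]; simp [hjl]; ring
    · intro m _ hm
      rw [hbi m hm]; simp [Ne.symm hm]
    · simp
  have e3 : ∀ x, b.coord l x = b'.coord l x + c * b'.coord j x := by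
    intro x
    rw [affineMap_eq_sum b' (b.coord l) x, Finset.sum_eq_add l j (Ne.symm hjl)]
    · rw [hbj, hcoord, hbi l hjl.symm]; simp [hjl.symm]; ring
    · intro m _ hm
      rw [hbi m hm.2]; simp [Ne.symm hm.1]
    · simp
    · simp
  refine ⟨b', hbi, hbj, ?_⟩
  have hc : 0 < 1 - c := by linarith
  ext x
  simp only [openSimplex, Set.mem_ofPred_eq]
  constructor
  · intro h
    refine ⟨fun i => ?_, ?_⟩
    · by_cases hj : i = j
      · subst hj; rw [e2]; exact mul_pos hc (h _)
      · by_cases hl : i = l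
        · subst hl; rw [e3]; have := mul_pos hc0 (h j); linarith [h i]
        · rw [e1 i x hj hl]; exact h i
    · rw [e2, e3]; nlinarith [mul_pos hc (h l)]
  · rintro ⟨h, h'⟩ i
    by_cases hj : i = j
    · subst hj; have := h i; rw [e2] at this; exact (mul_pos_iff_of_pos_left hc).1 this
    · by_cases hl : i = l
      · subst hl; rw [e2, e3] at h'
        have : 0 < (1 - c) * b'.coord i x := by linarith
        exact (mul_pos_iff_of_pos_left hc).1 this
      · rw [← e1 i x hj hl]; exact h i

variable (σ) in
/-- A set that is, up to a negligible set, a finite disjoint union of open simplices. -/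
def Dissectable (X : Set E) : Prop :=
  ∃ C : Set (Set E), C.Finite ∧
    (∀ T ∈ C, (∃ b : AffineBasis σ ℝ E, T = openSimplex b) ∧ T ⊆ X) ∧
    C.PairwiseDisjoint id ∧ Negligible (X \ ⋃₀ C)

theorem Dissectable.of_negligible {X : Set E} (h : Negligible X) : Dissectable σ X :=
  ⟨∅, by simp, by simp, by simp, by simpa using h⟩

theorem Dissectable.openSimplex (b : AffineBasis σ ℝ E) : Dissectable σ (openSimplex b) :=
  ⟨{GeomSCD.openSimplex b}, by simp, by simp, by simp, by simpa using Negligible.empty⟩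

/-- Dissection is transitive: pieces may be dissected in turn. -/
theorem Dissectable.biUnion {κ : Type*} {C : Set κ} (hC : C.Finite) {g : κ → Set E} {X : Set E}
    (hg : ∀ c ∈ C, Dissectable σ (g c)) (hX : ∀ c ∈ C, g c ⊆ X) (hd : C.PairwiseDisjoint g)
    (hn : Negligible (X \ ⋃ c ∈ C, g c)) : Dissectable σ X := by
  choose! D h1 h2 h3 h4 using hg
  refine ⟨⋃ c ∈ C, D c, hC.biUnion h1, ?_, ?_, ?_⟩
  · intro T hT
    simp only [Set.mem_iUnion] at hT
    obtain ⟨c, hc, hT⟩ := hT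
    exact ⟨(h2 c hc T hT).1, (h2 c hc T hT).2.trans (hX c hc)⟩
  · intro T hT T' hT' hne
    simp only [Set.mem_iUnion] at hT hT'
    obtain ⟨c, hc, hT⟩ := hT
    obtain ⟨c', hc', hT'⟩ := hT'
    by_cases hcc : c = c'
    · subst hcc; exact h3 c hc hT hT' hne
    · exact (hd hc hc' hcc).mono (h2 c hc T hT).2 (h2 c' hc' T' hT').2
  · refine (hn.union (Negligible.biUnion hC h4)).mono ?_
    rintro x ⟨hx, hx'⟩
    by_cases h : x ∈ ⋃ c ∈ C, g c
    · right
      simp only [Set.mem_iUnion] at h ⊢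
      obtain ⟨c, hc, h⟩ := h
      refine ⟨c, hc, h, fun hh => hx' ?_⟩
      obtain ⟨T, hT, hxT⟩ := hh
      exact ⟨T, by simp only [Set.mem_iUnion]; exact ⟨c, hc, hT⟩, hxT⟩
    · exact Or.inl ⟨hx, h⟩

/-- Induction on the number of vertices where `f` does not vanish. If `f` takes both signs at
vertices, an edge is cut at its zero of `f`; each half replaces a nonzero vertex by a zero one.
Otherwise `f` has constant sign and the intersection is the whole simplex or empty. -/
theorem dissectable_openSimplex_inter_pos (f : E →ᵃ[ℝ] ℝ) (n : ℕ) (b : AffineBasis σ ℝ E)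
    (hn : (Finset.univ.filter fun i => f (b i) ≠ 0).card = n) :
    Dissectable σ (openSimplex b ∩ {x | 0 < f x}) := by
  induction n using Nat.strong_induction_on generalizing b with
  | _ n ih =>
  by_cases hpos : ∃ j, 0 < f (b j)
  · by_cases hneg : ∃ l, f (b l) < 0
    · obtain ⟨j, hj⟩ := hpos
      obtain ⟨l, hl⟩ := hneg
      have hjl : j ≠ l := by rintro rfl; linarith
      -- The position of the zero of `f` on the edge from `j` to `l`.
      set c : ℝ := f (b j) / (f (b j) - f (b l)) with hc
      have hd : 0 < f (b j) - f (b l) := by linarith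
      have hc0 : 0 < c := div_pos hj hd
      have hc1 : c < 1 := (div_lt_one hd).2 (by linarith)
      have hf0 : f (AffineMap.lineMap (b j) (b l) c) = 0 := by
        rw [AffineMap.apply_lineMap, AffineMap.lineMap_apply_module, smul_eq_mul, smul_eq_mul, hc]
        field_simp
        ring
      obtain ⟨b₁, h11, h12, h13⟩ := exists_edge_bisection b hjl hc0 hc1
      obtain ⟨b₂, h21, h22, h23⟩ := exists_edge_bisection b hjl.symm (c := 1 - c)
        (by linarith) (by linarith)
      have h22' : b₂ l = AffineMap.lineMap (b j) (b l) c := by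
        rw [h22, AffineMap.lineMap_apply_one_sub]
      have hcard : ∀ (b' : AffineBasis σ ℝ E) (m : σ), f (b m) ≠ 0 → f (b' m) = 0 →
          (∀ i, i ≠ m → b' i = b i) →
          (Finset.univ.filter fun i => f (b' i) ≠ 0).card < n := by
        intro b' m hm hm' hi
        rw [← hn]
        refine Finset.card_lt_card (Finset.ssubset_iff_of_subset ?_ |>.2 ⟨m, ?_, ?_⟩)
        · intro i hi'
          simp only [Finset.mem_filter, Finset.mem_univ, true_and] at hi' ⊢
          have : i ≠ m := by rintro rfl; exact hi' hm'
          rwa [← hi i this]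
        · simpa using hm
        · simpa using hm'
      have d1 := ih _ (hcard b₁ j hj.ne' (by rw [h12, hf0]) h11) b₁ rfl
      have d2 := ih _ (hcard b₂ l hl.ne (by rw [h22', hf0]) h21) b₂ rfl
      have m1 : ∀ x, x ∈ openSimplex b₁ ↔
          (x ∈ openSimplex b ∧ c * b.coord j x < (1 - c) * b.coord l x) := fun x => by rw [h13]; rfl
      have m2 : ∀ x, x ∈ openSimplex b₂ ↔
          (x ∈ openSimplex b ∧ (1 - c) * b.coord l x < c * b.coord j x) := fun x => by
        rw [h23]; simp
      refine Dissectable.biUnion (C := (Set.univ : Set Bool)) Set.finite_univ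
        (g := fun t => bif t then openSimplex b₁ ∩ {x | 0 < f x}
          else openSimplex b₂ ∩ {x | 0 < f x}) ?_ ?_ ?_ ?_
      · rintro (_ | _) - <;> assumption
      · rintro (_ | _) - x ⟨hx, hx'⟩
        · exact ⟨((m2 x).1 hx).1, hx'⟩
        · exact ⟨((m1 x).1 hx).1, hx'⟩
      · have : Disjoint (openSimplex b₁ ∩ {x | 0 < f x}) (openSimplex b₂ ∩ {x | 0 < f x}) := by
          rw [Set.disjoint_left]
          rintro x ⟨hx, -⟩ ⟨hx', -⟩
          have := ((m1 x).1 hx).2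
          have := ((m2 x).1 hx').2
          linarith
        rintro (_ | _) - (_ | _) - hne
        · exact absurd rfl hne
        · exact this.symm
        · exact this
        · exact absurd rfl hne
      -- Only the wall between the two halves is lost.
      · refine (Negligible.zeros (c • b.coord j - (1 - c) • b.coord l) (x := b j) ?_).mono ?_
        · simp [hjl.symm, hc0.ne']
        · rintro x ⟨⟨hx, hx'⟩, hn⟩
          simp only [Set.mem_univ, Set.iUnion_true, Set.mem_iUnion, not_exists] at hn
          have n1 := hn true
          have n2 := hn false
          simp only [cond_true, cond_false, Set.mem_inter_iff, m1, m2, hx, hx', true_and,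
            and_true, not_lt] at n1 n2
          have := le_antisymm n1 n2
          simp only [Set.mem_ofPred_eq, AffineMap.coe_sub, Pi.sub_apply, AffineMap.coe_smul,
            Pi.smul_apply, smul_eq_mul]
          linarith
    · push Not at hneg
      obtain ⟨j, hj⟩ := hpos
      have : openSimplex b ∩ {x | 0 < f x} = openSimplex b := by
        refine Set.inter_eq_left.2 fun x hx => ?_
        show 0 < f x
        rw [affineMap_eq_sum b f x]
        exact Finset.sum_pos' (fun i _ => mul_nonneg (hx i).le (hneg i))
          ⟨j, Finset.mem_univ j, mul_pos (hx j) hj⟩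
      rw [this]
      exact Dissectable.openSimplex b
  · push Not at hpos
    refine Dissectable.of_negligible (Negligible.empty.mono ?_)
    rintro x ⟨hx, hx'⟩
    simp only [Set.mem_ofPred_eq, affineMap_eq_sum b f x] at hx'
    exact absurd hx' (not_lt.2 (Finset.sum_nonpos fun i _ =>
      mul_nonpos_of_nonneg_of_nonpos (hx i).le (hpos i)))

theorem dissectable_openSimplex_inter (L : List (E →ᵃ[ℝ] ℝ)) (b : AffineBasis σ ℝ E) :
    Dissectable σ (openSimplex b ∩ {x | ∀ f ∈ L, 0 < f x}) := by
  induction L generalizing b with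
  | nil => simpa using Dissectable.openSimplex b
  | cons f L ih =>
    obtain ⟨C, h1, h2, h3, h4⟩ := dissectable_openSimplex_inter_pos f _ b rfl
    refine Dissectable.biUnion h1 (g := fun T => T ∩ {x | ∀ f ∈ L, 0 < f x}) ?_ ?_ ?_ ?_
    · intro T hT
      obtain ⟨⟨b', rfl⟩, -⟩ := h2 T hT
      exact ih b'
    · rintro T hT x ⟨hx, hx'⟩
      have := (h2 T hT).2 hx
      refine ⟨this.1, ?_⟩
      intro g hg
      rcases List.mem_cons.1 hg with rfl | hg
      · exact this.2
      · exact hx' g hg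
    · intro T hT T' hT' hne
      exact (h3 hT hT' hne).mono Set.inter_subset_left Set.inter_subset_left
    · refine h4.mono ?_
      rintro x ⟨⟨hx, hx'⟩, hn⟩
      refine ⟨⟨hx, hx' f (by simp)⟩, ?_⟩
      rintro ⟨T, hT, hxT⟩
      apply hn
      simp only [Set.mem_iUnion]
      exact ⟨T, hT, hxT, fun g hg => hx' g (List.mem_cons_of_mem f hg)⟩

theorem isOpen_openSimplex (b : AffineBasis σ ℝ E) : IsOpen (openSimplex b) := by
  rw [openSimplex, ← b.interior_convexHull]
  exact isOpen_interior

theorem openSimplex_nonempty (b : AffineBasis σ ℝ E) : (openSimplex b).Nonempty := by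
  rw [openSimplex, ← b.interior_convexHull]
  have : FiniteDimensional ℝ E := b.finiteDimensional
  exact ⟨_, b.centroid_mem_interior_convexHull⟩

theorem convex_openSimplex (b : AffineBasis σ ℝ E) : Convex ℝ (openSimplex b) := by
  rw [openSimplex, ← b.interior_convexHull]
  exact (convex_convexHull ℝ _).interior

/-- An affine function that is nonnegative on an open simplex is nonnegative at its vertices. -/
theorem nonneg_vertex_of_nonneg_openSimplex (b : AffineBasis σ ℝ E) (f : E →ᵃ[ℝ] ℝ)
    (h : ∀ x ∈ openSimplex b, 0 ≤ f x) (j : σ) : 0 ≤ f (b j) := by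
  have : FiniteDimensional ℝ E := b.finiteDimensional
  have hcl : b j ∈ closure (openSimplex b) := by
    have hne : (interior (convexHull ℝ (Set.range b))).Nonempty :=
      ⟨_, b.centroid_mem_interior_convexHull⟩
    rw [openSimplex, ← b.interior_convexHull,
      (convex_convexHull ℝ _).closure_interior_eq_closure_of_nonempty_interior hne]
    exact subset_closure (subset_convexHull ℝ _ ⟨j, rfl⟩)
  exact closure_minimal (t := {x | 0 ≤ f x}) h
    (isClosed_le continuous_const f.continuous_of_finiteDimensional) hcl

/-- An open simplex around the origin is a neighbourhood of it, so a suitable multiple absorbs any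
bounded set. -/
theorem exists_subset_openSimplex [FiniteDimensional ℝ E] {n : ℕ}
    (hn : Module.finrank ℝ E = n) {X : Set E} (hX : Bornology.IsBounded X) :
    ∃ b : AffineBasis (Fin (n + 1)) ℝ E, X ⊆ openSimplex b := by
  subst hn
  obtain ⟨b, hb, -⟩ := exists_mem_interior_convexHull_affineBasis
    (Filter.univ_mem : (Set.univ : Set E) ∈ nhds (0 : E))
  have hnh : openSimplex b ∈ nhds (0 : E) := by
    rw [openSimplex, ← b.interior_convexHull]
    exact isOpen_interior.mem_nhds hb
  obtain ⟨r, hr, h⟩ := ((NormedSpace.isVonNBounded_iff ℝ).2 hX hnh).exists_pos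
  have hsub := h r (by simp [abs_of_pos hr])
  let u : ℝˣ := Units.mk0 r hr.ne'
  refine ⟨u • b, fun x hx => ?_⟩
  obtain ⟨y, hy, rfl⟩ := hsub hx
  intro i
  have : (u • b).coord i (r • y) = b.coord i y := by
    rw [AffineBasis.coord_smul]
    simp only [AffineMap.coe_comp, Function.comp_apply, LinearMap.coe_toAffineMap]
    congr 1
    exact inv_smul_smul u y
  simp only [this]
  exact hy i

/-- A bounded set cut out by finitely many strict affine inequalities is dissectable. -/
theorem dissectable_of_isBounded [FiniteDimensional ℝ E] {n : ℕ} (hn : Module.finrank ℝ E = n)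
    (L : List (E →ᵃ[ℝ] ℝ)) (hb : Bornology.IsBounded {x : E | ∀ f ∈ L, 0 < f x}) :
    Dissectable (Fin (n + 1)) {x : E | ∀ f ∈ L, 0 < f x} := by
  obtain ⟨b, hsub⟩ := exists_subset_openSimplex hn hb
  have := dissectable_openSimplex_inter L b
  rwa [Set.inter_eq_right.2 hsub] at this

end Dissection

end GeomSCD

namespace GeomSCD

/-! ### Families of chains with affine parameters -/

section ChainBundle

variable {ι : Type*} [Fintype ι] [DecidableEq ι]
variable {E : Type*} [NormedAddCommGroup E] [NormedSpace ℝ E]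

theorem rk_add (x y : ι → ℝ) : rk (x + y) = rk x + rk y := by
  simp [rk, Finset.sum_add_distrib]

theorem rk_smul (c : ℝ) (x : ι → ℝ) : rk (c • x) = c * rk x := by
  simp [rk, Finset.mul_sum]

theorem rk_single (i : ι) : rk (Pi.single i (1 : ℝ)) = 1 := by
  simp [rk]

theorem rk_add_smul_single (x : ι → ℝ) (u : ℝ) (i : ι) :
    rk (x + u • Pi.single i (1 : ℝ)) = rk x + u := by
  rw [rk_add, rk_smul, rk_single, mul_one]

/-- The rank as an affine function. -/
def rkAff : (ι → ℝ) →ᵃ[ℝ] ℝ :=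
  LinearMap.toAffineMap
    { toFun := rk
      map_add' := rk_add
      map_smul' := fun c x => by simpa using rk_smul c x }

@[simp]
theorem rkAff_apply (x : ι → ℝ) : rkAff x = rk x := rfl

variable (ι E) in
/-- A family of piecewise linear chains with parameter space `E`: the chain with parameter `z`
runs through the points `pt 0 z, …, pt (k + 1) z`, the step from `pt l z` to `pt (l + 1) z`
being parallel to the basis vector `e (dir l)`. -/
structure ChainBundle where
  k : ℕ
  dir : ℕ → ι
  pt : ℕ → E →ᵃ[ℝ] (ι → ℝ)
  len : ℕ → E →ᵃ[ℝ] ℝ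
  step : ∀ l z, pt (l + 1) z = pt l z + len l z • Pi.single (dir l) (1 : ℝ)
  transverse : ∀ l z z' (t : ℝ), pt l z = pt l z' + t • Pi.single (dir l) (1 : ℝ) → z = z'

namespace ChainBundle

variable (M : ChainBundle ι E)

/-- The affine chart of the `l`-th step. -/
def chart (l : ℕ) : E × ℝ →ᵃ[ℝ] (ι → ℝ) :=
  (M.pt l).comp AffineMap.fst +
    ((LinearMap.snd ℝ E ℝ).smulRight (Pi.single (M.dir l) (1 : ℝ))).toAffineMap

theorem chart_apply (l : ℕ) (z : E) (u : ℝ) :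
    M.chart l (z, u) = M.pt l z + u • Pi.single (M.dir l) (1 : ℝ) := by
  simp [chart]

theorem chart_zero (l : ℕ) (z : E) : M.chart l (z, 0) = M.pt l z := by
  simp [chart_apply]

theorem chart_len (l : ℕ) (z : E) : M.chart l (z, M.len l z) = M.pt (l + 1) z := by
  rw [chart_apply, M.step]

theorem rk_chart (l : ℕ) (z : E) (u : ℝ) : rk (M.chart l (z, u)) = rk (M.pt l z) + u := by
  rw [chart_apply, rk_add_smul_single]

theorem rk_pt_succ (l : ℕ) (z : E) : rk (M.pt (l + 1) z) = rk (M.pt l z) + M.len l z := by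
  rw [← chart_len, rk_chart]

theorem chart_injective (l : ℕ) : Function.Injective (M.chart l) := by
  rintro ⟨z, u⟩ ⟨z', u'⟩ h
  rw [chart_apply, chart_apply] at h
  have h2 : z = z' := M.transverse l z z' (u' - u) (by
    rw [sub_smul, ← add_sub_assoc, ← h, add_sub_cancel_right])
  subst h2
  have h3 := congrFun (add_left_cancel h) (M.dir l)
  simp at h3
  rw [h3]

theorem chart_inj {l : ℕ} {z z' : E} {u u' : ℝ} (h : M.chart l (z, u) = M.chart l (z', u')) :
    z = z' ∧ u = u' := by
  simpa using M.chart_injective l h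

theorem rk_pt_mono {z : E} (hz : ∀ l, 0 ≤ M.len l z) : Monotone fun l => rk (M.pt l z) :=
  monotone_nat_of_le_succ fun l => by rw [rk_pt_succ]; linarith [hz l]

/-- Each step raises the rank by its length, so without a gain in rank all steps in between have
length zero. -/
theorem pt_eq_of_rk_le {z : E} (hz : ∀ l, 0 ≤ M.len l z) {m n : ℕ} (hmn : m ≤ n)
    (h : rk (M.pt n z) ≤ rk (M.pt m z)) : M.pt n z = M.pt m z := by
  induction n, hmn using Nat.le_induction with
  | base => rfl
  | succ n hmn ih =>
    have h1 := M.rk_pt_mono hz hmn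
    have h2 := M.rk_pt_succ n z
    have h3 := hz n
    simp only at h1
    have h4 : M.len n z = 0 := by linarith
    rw [M.step, h4, zero_smul, add_zero]
    exact ih (by linarith)

/-- The point `x` lies on the chain with parameter `z`, strictly between its end points. -/
def Mem (z : E) (x : ι → ℝ) : Prop :=
  (∃ l ≤ M.k, ∃ u, 0 ≤ u ∧ u ≤ M.len l z ∧ x = M.chart l (z, u)) ∧
    rk (M.pt 0 z) < rk x ∧ rk x < rk (M.pt (M.k + 1) z)

theorem mem_of_lt {z : E} (hz : ∀ l, 0 ≤ M.len l z) {l : ℕ} (hl : l ≤ M.k) {u : ℝ} (h0 : 0 < u)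
    (h1 : u < M.len l z) : M.Mem z (M.chart l (z, u)) := by
  refine ⟨⟨l, hl, u, h0.le, h1.le, rfl⟩, ?_, ?_⟩
  · have := M.rk_pt_mono hz (Nat.zero_le l)
    rw [rk_chart]
    simp only at this
    linarith
  · have := M.rk_pt_mono hz (Nat.succ_le_succ hl)
    rw [rk_chart]
    simp only [Nat.succ_eq_add_one, rk_pt_succ] at this ⊢
    linarith

/-- The chains with parameters in `U` have disjoint interiors. -/
def Separates (U : Set E) : Prop :=
  ∀ z ∈ U, ∀ z' ∈ U, ∀ x, M.Mem z x → M.Mem z' x → z = z'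

/-- The ranks of the end points of every chain add up to `r`. -/
def Balanced (r : ℝ) : Prop := ∀ z, rk (M.pt 0 z) + rk (M.pt (M.k + 1) z) = r

/-- The weak hyperplane condition for the turning points of the chains with parameters in `U`. -/
def WeakHyperplane (U : Set E) : Prop :=
  ∀ l < M.k, ∃ (a : ι → ℝ) (r : ℝ), a ≠ 0 ∧ (∀ z ∈ U, ∑ c, a c * M.pt (l + 1) z c = r) ∧
    a (M.dir l) = a (M.dir (l + 1))

end ChainBundle

/-- The point `z` lies in the relative interior of the face `A` of the simplex with
vertices `b`. -/
def OnFace {σ : Type*} (b : AffineBasis σ ℝ E) (A : Finset σ) (z : E) : Prop :=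
  (∀ j ∈ A, 0 < b.coord j z) ∧ ∀ j, j ∉ A → b.coord j z = 0

theorem onFace_univ {σ : Type*} [Fintype σ] (b : AffineBasis σ ℝ E) (z : E) :
    OnFace b Finset.univ z ↔ z ∈ openSimplex b := by
  simp [OnFace, openSimplex]

theorem OnFace.nonneg {σ : Type*} {b : AffineBasis σ ℝ E} {A : Finset σ} {z : E}
    (h : OnFace b A z) (j : σ) : 0 ≤ b.coord j z := by
  by_cases hj : j ∈ A
  · exact (h.1 j hj).le
  · exact (h.2 j hj).ge

theorem PartialSimplex.mem_carrier_iff {d : ℕ} (S : PartialSimplex ι d)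
    (b : AffineBasis (Fin (d + 1)) ℝ E) (f : E →ᵃ[ℝ] (ι → ℝ)) (hv : ∀ j, S.vertex j = f (b j))
    (x : ι → ℝ) : x ∈ S.carrier ↔ ∃ A ∈ S.faces, ∃ z, OnFace b A z ∧ x = f z := by
  simp only [PartialSimplex.carrier, Set.mem_iUnion, exists_prop]
  refine exists_congr fun A => and_congr_right fun _ => ?_
  constructor
  · rintro ⟨w, w1, w2, w3, rfl⟩
    have hc : ∀ j, b.coord j (Finset.univ.affineCombination ℝ b w) = w j := fun j =>
      b.coord_apply_combination_of_mem (Finset.mem_univ j) w3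
    refine ⟨Finset.univ.affineCombination ℝ b w, ⟨?_, ?_⟩, ?_⟩
    · intro j hj; rw [hc]; exact w1 j hj
    · intro j hj; rw [hc]; exact w2 j hj
    · rw [affineMap_eq_sum b f]
      simp only [hc, hv]
  · rintro ⟨z, hz, rfl⟩
    refine ⟨fun j => b.coord j z, hz.1, hz.2, b.sum_coord_apply_eq_one z, ?_⟩
    rw [affineMap_eq_sum b f]
    simp only [hv]

/-- Injectivity of the chart forces the two ends of a segment of the sweep to have the same
parameter, so the segments are exactly the steps of the chains. -/
theorem ChainBundle.mem_sweep_iff (M : ChainBundle ι E) (l : ℕ) {d : ℕ}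
    {A A' : PartialSimplex ι d} (b : AffineBasis (Fin (d + 1)) ℝ E)
    (hA : ∀ j, A.vertex j = M.pt l (b j)) (hA' : ∀ j, A'.vertex j = M.pt (l + 1) (b j))
    (hf : A'.faces = A.faces) (x : ι → ℝ) :
    x ∈ sweep (M.dir l) A.carrier A'.carrier ↔
      ∃ B ∈ A.faces, ∃ z, OnFace b B z ∧ ∃ u, 0 ≤ u ∧ u ≤ M.len l z ∧ x = M.chart l (z, u) := by
  constructor
  · rintro ⟨p, hp, q, hq, ⟨t, ht, htq⟩, hx⟩
    obtain ⟨B, hB, z, hz, rfl⟩ := (A.mem_carrier_iff b _ hA p).1 hp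
    obtain ⟨B', hB', z', hz', rfl⟩ := (A'.mem_carrier_iff b _ hA' q).1 hq
    rw [← M.chart_len, ← M.chart_apply] at htq
    obtain ⟨rfl, htl⟩ := M.chart_inj htq
    refine ⟨B, hB, z', hz, ?_⟩
    rw [segment_eq_image'] at hx
    obtain ⟨θ, hθ, rfl⟩ := hx
    refine ⟨θ * t, mul_nonneg hθ.1 ht, ?_, ?_⟩
    · rw [htl]; exact mul_le_of_le_one_left ht hθ.2
    · simp only [M.step, M.chart_apply, htl, add_sub_cancel_left, smul_smul]
  · rintro ⟨B, hB, z, hz, u, hu0, hu1, rfl⟩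
    refine ⟨M.pt l z, (A.mem_carrier_iff b _ hA _).2 ⟨B, hB, z, hz, rfl⟩, M.pt (l + 1) z,
      (A'.mem_carrier_iff b _ hA' _).2 ⟨B, hf ▸ hB, z, hz, rfl⟩,
      ⟨M.len l z, hu0.trans hu1, M.step l z⟩, ?_⟩
    rw [segment_eq_image']
    rcases (hu0.trans hu1).eq_or_lt with h0 | h0
    · have : u = 0 := le_antisymm (h0 ▸ hu1) hu0
      exact ⟨0, by simp, by rw [this, M.chart_zero]; simp⟩
    · refine ⟨u / M.len l z, ⟨div_nonneg hu0 h0.le, (div_le_one h0).2 hu1⟩, ?_⟩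
      simp only
      rw [M.step, M.chart_apply, add_sub_cancel_left, smul_smul, div_mul_cancel₀ _ h0.ne']

/-- The chains of `M` with parameters in the simplex with vertices `b` form the swipe
sequence `S`. -/
structure Realizes (S : SwipeSeq ι) (M : ChainBundle ι E)
    (b : AffineBasis (Fin (S.d + 1)) ℝ E) : Prop where
  k_eq : M.k = S.k
  dir_eq : ∀ l : Fin (S.k + 1), (S.swipe l).dir = M.dir l
  start_eq : ∀ (l : Fin (S.k + 1)) j, (S.swipe l).start.vertex j = M.pt l (b j)
  finish_eq : ∀ (l : Fin (S.k + 1)) j, (S.swipe l).finish.vertex j = M.pt (l + 1) (b j)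

namespace Realizes

variable {S : SwipeSeq ι} {M : ChainBundle ι E} {b : AffineBasis (Fin (S.d + 1)) ℝ E}

theorem mem_start (R : Realizes S M b) (l : Fin (S.k + 1)) {z : E} (hz : z ∈ openSimplex b) :
    M.pt l z ∈ (S.swipe l).start.carrier :=
  ((S.swipe l).start.mem_carrier_iff b _ (R.start_eq l) _).2
    ⟨_, (S.swipe l).start.univ_mem, z, (onFace_univ b z).2 hz, rfl⟩

theorem mem_finish (R : Realizes S M b) (l : Fin (S.k + 1)) {z : E} (hz : z ∈ openSimplex b) :
    M.pt (l + 1) z ∈ (S.swipe l).finish.carrier :=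
  ((S.swipe l).finish.mem_carrier_iff b _ (R.finish_eq l) _).2
    ⟨_, (S.swipe l).finish.univ_mem, z, (onFace_univ b z).2 hz, rfl⟩

theorem mem_swipe_iff (R : Realizes S M b) (l : Fin (S.k + 1)) (x : ι → ℝ) :
    x ∈ (S.swipe l).carrier ↔ ∃ B ∈ (S.swipe l).start.faces, ∃ z, OnFace b B z ∧
      ∃ u, 0 ≤ u ∧ u ≤ M.len l z ∧ x = M.chart l (z, u) := by
  rw [Swipe.carrier, R.dir_eq l]
  exact M.mem_sweep_iff l b (R.start_eq l) (R.finish_eq l) (S.swipe l).faces_eq x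

theorem chart_mem_swipe (R : Realizes S M b) (l : Fin (S.k + 1)) {z : E}
    (hz : z ∈ openSimplex b) {u : ℝ} (h0 : 0 ≤ u) (h1 : u ≤ M.len l z) :
    M.chart l (z, u) ∈ (S.swipe l).carrier :=
  (R.mem_swipe_iff l _).2
    ⟨_, (S.swipe l).start.univ_mem, z, (onFace_univ b z).2 hz, u, h0, h1, rfl⟩

theorem eq_pt_of_mem_start (R : Realizes S M b) {l : Fin (S.k + 1)} {z : E} {u : ℝ}
    (h : M.chart l (z, u) ∈ (S.swipe l).start.carrier) : M.chart l (z, u) = M.pt l z := by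
  obtain ⟨A, -, z', -, hx⟩ := ((S.swipe l).start.mem_carrier_iff b _ (R.start_eq l) _).1 h
  rw [← M.chart_zero] at hx
  obtain ⟨rfl, rfl⟩ := M.chart_inj hx
  rw [M.chart_zero]

theorem eq_pt_of_mem_finish (R : Realizes S M b) {l : Fin (S.k + 1)} {z : E} {u : ℝ}
    (h : M.chart l (z, u) ∈ (S.swipe l).finish.carrier) :
    M.chart l (z, u) = M.pt (l + 1) z := by
  obtain ⟨A, -, z', -, hx⟩ := ((S.swipe l).finish.mem_carrier_iff b _ (R.finish_eq l) _).1 h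
  rw [← M.chart_len] at hx
  obtain ⟨rfl, hu⟩ := M.chart_inj hx
  rw [hu, M.chart_len]

/-- The end of a step can lie in the starting turning set of that step only if the step over `z` is
trivial; hence membership in starting sets carries `x` back along its chain. `eq_pt_of_finish` is
the same argument forwards. -/
theorem eq_pt_zero (R : Realizes S M b) {z : E} {x : ι → ℝ} (m : ℕ) (hm : m ≤ S.k)
    (hx : x = M.pt m z) (h : ∀ l : Fin (S.k + 1), l.1 < m → x ∈ (S.swipe l).start.carrier) :
    x = M.pt 0 z := by
  induction m with
  | zero => exact hx
  | succ m ih =>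
    have h1 := h ⟨m, by omega⟩ (by simp)
    rw [hx, ← M.chart_len] at h1
    have := R.eq_pt_of_mem_start (l := ⟨m, by omega⟩) h1
    refine ih (by omega) ?_ fun l hl => h l (by omega)
    rw [hx, ← M.chart_len, this]

theorem eq_pt_of_finish (R : Realizes S M b) {z : E} {x : ι → ℝ} {m n : ℕ} (hmn : m ≤ n)
    (hn : n ≤ S.k + 1) (hx : x = M.pt m z)
    (h : ∀ l : Fin (S.k + 1), m ≤ l.1 → l.1 < n → x ∈ (S.swipe l).finish.carrier) :
    x = M.pt n z := by
  induction n, hmn using Nat.le_induction with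
  | base => exact hx
  | succ n hmn ih =>
    have hx' := ih (by omega) fun l hl hl' => h l hl (by omega)
    have h1 := h ⟨n, by omega⟩ hmn (by simp)
    rw [hx', ← M.chart_zero] at h1 ⊢
    exact R.eq_pt_of_mem_finish (l := ⟨n, by omega⟩) h1

/-- A halted point is carried along its chain to one of the two ends, where the strict rank bounds
fail. -/
theorem not_halted (R : Realizes S M b) {l : Fin (S.k + 1)} {z : E} {u : ℝ}
    (h0 : rk (M.pt 0 z) < rk (M.chart l (z, u)))
    (h1 : rk (M.chart l (z, u)) < rk (M.pt (M.k + 1) z)) : ¬ S.Halted l (M.chart l (z, u)) := by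
  rintro (⟨h, hl⟩ | ⟨h, hl⟩)
  · have := R.eq_pt_zero l.1 (by omega) (R.eq_pt_of_mem_start hl) fun l' hl' => (h l' hl').1
    rw [this] at h0
    exact lt_irrefl _ h0
  · have := R.eq_pt_of_finish (m := l.1 + 1) (n := S.k + 1) (by omega) le_rfl
      (R.eq_pt_of_mem_finish hl) fun l' hl' _ => (h l' (by simpa using hl')).2
    rw [this, R.k_eq] at h1
    exact lt_irrefl _ h1

theorem mem_trimmed (R : Realizes S M b) {l : Fin (S.k + 1)} {z : E} {u : ℝ}
    (hz : z ∈ openSimplex b) (hu0 : 0 ≤ u) (hu1 : u ≤ M.len l z)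
    (h0 : rk (M.pt 0 z) < rk (M.chart l (z, u)))
    (h1 : rk (M.chart l (z, u)) < rk (M.pt (M.k + 1) z)) : M.chart l (z, u) ∈ S.trimmed l :=
  ⟨R.chart_mem_swipe l hz hu0 hu1, R.not_halted h0 h1⟩

/-- If a point of two different chains lies in the ending turning sets of all swipes in between,
the chains agree. -/
theorem eq_of_mem_finish (R : Realizes S M b) {i j : Fin (S.k + 1)} (hij : i < j) {z z' : E}
    {u u' : ℝ} (hx : M.chart i (z, u) = M.chart j (z', u'))
    (hi : M.chart i (z, u) ∈ (S.swipe i).finish.carrier)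
    (h : ∀ l, i < l → l < j → M.chart i (z, u) ∈ (S.swipe l).finish.carrier) : z = z' := by
  have hij' : i.1 < j.1 := hij
  have := R.eq_pt_of_finish (m := i.1 + 1) (n := j.1) hij' (by omega)
    (R.eq_pt_of_mem_finish hi) fun l hl hl' => h l (Nat.lt_of_succ_le hl) hl'
  rw [hx, ← M.chart_zero] at this
  exact (M.chart_inj this).1.symm

end Realizes

/-! ### Properties of the chains of a given snake -/

section OfSnake

/-- This and `exists_chart_of_mem_snake` enclose a snake, real or fake, between its open chains over
the open simplex and its closed chains over the closed simplex; the difference is negligible. -/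
theorem mem_snake_carrier {F : Snake ι} {M : ChainBundle ι E}
    {b : AffineBasis (Fin (F.seq.d + 1)) ℝ E} (R : Realizes F.seq M b) {z : E}
    (hz : z ∈ openSimplex b) {x : ι → ℝ} (hx : M.Mem z x) : x ∈ F.carrier := by
  obtain ⟨⟨l, hl, u, h0, h1, rfl⟩, h2, h3⟩ := hx
  have hl' : l < F.seq.k + 1 := by rw [← R.k_eq]; omega
  have := R.mem_trimmed (l := ⟨l, hl'⟩) hz h0 h1 h2 h3
  cases F with
  | real S h => exact Set.mem_iUnion.2 ⟨_, this.1⟩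
  | fake S h => exact Set.mem_iUnion.2 ⟨_, this⟩

/-- A common point on steps `i < j` is not halted, so either snake condition applies and places it
in all ending turning sets from `i` to `j - 1`. It is therefore the `j`-th turning point of the
first chain, and injectivity of the `j`-th chart identifies the chains. -/
theorem separates_of_realizes {F : Snake ι} {M : ChainBundle ι E}
    {b : AffineBasis (Fin (F.seq.d + 1)) ℝ E} (R : Realizes F.seq M b) :
    M.Separates (openSimplex b) := by
  intro z hz z' hz' x hx hx'
  obtain ⟨⟨i, hi, u, hu0, hu1, hxu⟩, h2, h3⟩ := hx
  obtain ⟨⟨j, hj, v, hv0, hv1, hxv⟩, h2', h3'⟩ := hx'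
  wlog hij : i ≤ j generalizing i j u v z z'
  · exact (this z' hz' z hz j hj v hv0 hv1 hxv h2' h3' i hi u hu0 hu1 hxu h2 h3
      (by omega)).symm
  rcases hij.eq_or_lt with rfl | hij
  · exact (M.chart_inj (hxu.symm.trans hxv)).1
  have hi' : i < F.seq.k + 1 := by rw [← R.k_eq]; omega
  have hj' : j < F.seq.k + 1 := by rw [← R.k_eq]; omega
  rw [hxu] at h2 h3
  rw [hxv] at h2' h3'
  have e := hxu.symm.trans hxv
  have m1 := R.mem_trimmed (l := ⟨i, hi'⟩) hz hu0 hu1 h2 h3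
  have m2 := R.mem_trimmed (l := ⟨j, hj'⟩) hz' hv0 hv1 h2' h3'
  have hlt : (⟨i, hi'⟩ : Fin (F.seq.k + 1)) < ⟨j, hj'⟩ := hij
  simp only [← e] at m2
  cases F with
  | real S h =>
    obtain ⟨a1, -, a3⟩ := h _ _ hlt _ ⟨m1.1, m2.1⟩
    exact R.eq_of_mem_finish hlt e a1 fun l h1 h2 => (a3 l h1 h2).2
  | fake S h =>
    obtain ⟨a1, -, a3⟩ := h _ _ hlt _ ⟨m1, m2⟩
    exact R.eq_of_mem_finish hlt e a1.2 fun l h1 h2 => (a3 l h1 h2).2.2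

theorem exists_chart_of_mem_snake {F : Snake ι} {M : ChainBundle ι E}
    {b : AffineBasis (Fin (F.seq.d + 1)) ℝ E} (R : Realizes F.seq M b) {x : ι → ℝ}
    (hx : x ∈ F.carrier) : ∃ l ≤ M.k, ∃ z u, (∀ j, 0 ≤ b.coord j z) ∧ 0 ≤ u ∧
      u ≤ M.len l z ∧ x = M.chart l (z, u) := by
  have : ∃ l, x ∈ (F.seq.swipe l).carrier := by
    cases F with
    | real S h => exact Set.mem_iUnion.1 hx
    | fake S h =>
      obtain ⟨l, hl⟩ := Set.mem_iUnion.1 hx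
      exact ⟨l, hl.1⟩
  obtain ⟨l, hl⟩ := this
  obtain ⟨B, -, z, hz, u, hu0, hu1, rfl⟩ := (R.mem_swipe_iff l x).1 hl
  exact ⟨l, by rw [R.k_eq]; omega, z, u, hz.nonneg, hu0, hu1, rfl⟩

/-- The sum of the end ranks is affine in the parameter and constant on the vertices. -/
theorem balanced_of_realizes {F : Snake ι} {M : ChainBundle ι E}
    {b : AffineBasis (Fin (F.seq.d + 1)) ℝ E} (R : Realizes F.seq M b) {P : Set (ι → ℝ)}
    (h : F.IsSymmetric P) : M.Balanced (polytopeRank P) := by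
  intro z
  have key : (rkAff.comp (M.pt 0) + rkAff.comp (M.pt (M.k + 1))) z = polytopeRank P := by
    rw [affineMap_eq_sum b]
    have : ∀ j, (rkAff.comp (M.pt 0) + rkAff.comp (M.pt (M.k + 1))) (b j) = polytopeRank P := by
      intro j
      have h1 := h j
      rw [R.start_eq, R.finish_eq] at h1
      simpa [R.k_eq] using h1
    simp only [this, ← Finset.sum_smul, b.sum_coord_apply_eq_one, one_smul]
  simpa using key

theorem weakHyperplane_of_realizes {F : Snake ι} {M : ChainBundle ι E}
    {b : AffineBasis (Fin (F.seq.d + 1)) ℝ E} (R : Realizes F.seq M b)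
    (h : F.WeakHyperplane) : M.WeakHyperplane (openSimplex b) := by
  intro l hl
  rw [R.k_eq] at hl
  obtain ⟨a, r, h1, h2, h3⟩ := h ⟨l, hl⟩
  refine ⟨a, r, h1, fun z hz => h2 _ ?_, ?_⟩
  · exact R.mem_finish (Fin.castSucc ⟨l, hl⟩) hz
  · rw [R.dir_eq, R.dir_eq] at h3
    simpa using h3

end OfSnake

end ChainBundle

end GeomSCD

namespace GeomSCD

/-! ### The chain family of a compatible sequence of swipes -/

section FromSwipes

variable {ι : Type*} [Fintype ι] [DecidableEq ι]
variable {E : Type*} [NormedAddCommGroup E] [NormedSpace ℝ E]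
variable {σ : Type*} [Fintype σ] [DecidableEq σ]

/-- The affine map with given values on an affine basis. -/
noncomputable def affineOfVertices {F : Type*} [AddCommGroup F] [Module ℝ F]
    (b : AffineBasis σ ℝ E) (v : σ → F) : E →ᵃ[ℝ] F :=
  (Fintype.linearCombination ℝ v).toAffineMap.comp b.coords

theorem affineOfVertices_apply {F : Type*} [AddCommGroup F] [Module ℝ F]
    (b : AffineBasis σ ℝ E) (v : σ → F) (z : E) :
    affineOfVertices b v z = ∑ i, b.coord i z • v i := rfl

@[simp]
theorem affineOfVertices_vertex {F : Type*} [AddCommGroup F] [Module ℝ F]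
    (b : AffineBasis σ ℝ E) (v : σ → F) (j : σ) : affineOfVertices b v (b j) = v j := by
  simp [affineOfVertices_apply, b.coord_apply]

theorem linear_mem_vectorSpan (b : AffineBasis σ ℝ E) {F : Type*} [AddCommGroup F] [Module ℝ F]
    (f : E →ᵃ[ℝ] F) (ξ : E) : f.linear ξ ∈ vectorSpan ℝ (Set.range (f ∘ b)) := by
  have h : ξ ∈ vectorSpan ℝ (Set.range b) := by
    rw [← direction_affineSpan, b.tot]; simp
  rw [Set.range_comp, ← f.map_vectorSpan]
  exact Submodule.mem_map_of_mem h

theorem injective_linear_of_affineIndependent (b : AffineBasis σ ℝ E) {F : Type*}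
    [AddCommGroup F] [Module ℝ F] (f : E →ᵃ[ℝ] F) (h : AffineIndependent ℝ (f ∘ b)) {ξ : E}
    (hξ : f.linear ξ = 0) : ξ = 0 := by
  have hf : f ξ = f 0 := by
    have := f.linearMap_vsub ξ 0
    simp only [vsub_eq_sub, sub_zero, hξ] at this
    exact (sub_eq_zero.1 this.symm)
  rw [affineMap_eq_sum b f, affineMap_eq_sum b f 0] at hf
  have h0 : ∑ j, (b.coord j ξ - b.coord j 0) = 0 := by
    rw [Finset.sum_sub_distrib, b.sum_coord_apply_eq_one, b.sum_coord_apply_eq_one, sub_self]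
  have := affineIndependent_iff.1 h Finset.univ (fun j => b.coord j ξ - b.coord j 0) h0
    (by simp only [Function.comp_apply, sub_smul, Finset.sum_sub_distrib, hf, sub_self])
  exact b.ext_elem fun j => sub_eq_zero.1 (this j (Finset.mem_univ j))

/-- Turning points and step lengths are interpolated affinely from the vertices. Compatibility makes
consecutive steps fit; transversality and affine independence of the turning sets give
transversality of the family. -/
theorem exists_realizes (S : SwipeSeq ι) (b : AffineBasis (Fin (S.d + 1)) ℝ E) :
    ∃ M : ChainBundle ι E, Realizes S M b ∧ ∀ z ∈ openSimplex b, ∀ l, 0 ≤ M.len l z := by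
  choose t ht hv using fun l => (S.swipe l).translate
  -- A chain family is indexed by all naturals: past the last swipe the direction is kept, the
  -- length is zero and the turning points stay at the final turning set.
  let c : ℕ → Fin (S.k + 1) := fun l => ⟨min l S.k, by omega⟩
  have hc : ∀ l : Fin (S.k + 1), c l = l := fun l => Fin.ext (by simp [c]; omega)
  let V : ℕ → Fin (S.d + 1) → ι → ℝ := fun l =>
    if l ≤ S.k then (S.swipe (c l)).start.vertex else (S.swipe (c l)).finish.vertex
  let T : ℕ → Fin (S.d + 1) → ℝ := fun l => if l ≤ S.k then t (c l) else 0
  have hVstep : ∀ l j, V (l + 1) j = V l j + T l j • Pi.single (S.swipe (c l)).dir (1 : ℝ) := by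
    intro l j
    rcases lt_trichotomy l S.k with h | h | h
    · have e := S.compatible ⟨l, h⟩
      have c1 : c l = Fin.castSucc ⟨l, h⟩ := Fin.ext (by simp [c]; omega)
      have c2 : c (l + 1) = Fin.succ ⟨l, h⟩ := Fin.ext (by simp [c]; omega)
      have := hv (c l) j
      simp only [V, T, if_pos h.le, if_pos (Nat.succ_le_of_lt h)]
      rw [← this, c2, ← e, c1]
    · subst h
      have c2 : c (S.k + 1) = c S.k := Fin.ext (by simp [c])
      simp only [V, T, le_refl, if_true, if_neg (Nat.not_succ_le_self _), c2]
      exact hv (c S.k) j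
    · have c2 : c (l + 1) = c l := Fin.ext (by simp [c]; omega)
      simp [V, T, if_neg (not_le.2 h), if_neg (show ¬ l + 1 ≤ S.k by omega), c2]
  have hfin : ∀ l, V (l + 1) = (S.swipe (c l)).finish.vertex := by
    intro l
    funext j
    by_cases h : l ≤ S.k
    · rw [hVstep, hv]; simp only [V, T, if_pos h]
    · rw [hVstep]; simp [V, T, if_neg h]
  have hstep : ∀ l z, affineOfVertices b (V (l + 1)) z = affineOfVertices b (V l) z +
      affineOfVertices b (T l) z • Pi.single (S.swipe (c l)).dir (1 : ℝ) := by
    intro l z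
    simp only [affineOfVertices_apply, hVstep, smul_add, Finset.sum_add_distrib, smul_eq_mul,
      Finset.sum_smul, smul_smul]
  have htr : ∀ l ≤ S.k, ∀ z z' (r : ℝ), affineOfVertices b (V l) z =
      affineOfVertices b (V l) z' + r • Pi.single (S.swipe (c l)).dir (1 : ℝ) → z = z' := by
    intro l hl z z' r h
    have hV : V l = (S.swipe (c l)).start.vertex := if_pos hl
    have hcomp : (affineOfVertices b (V l)) ∘ b = (S.swipe (c l)).start.vertex := by
      funext j; simp [hV]
    have hlin := (affineOfVertices b (V l)).linearMap_vsub z z'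
    rw [vsub_eq_sub, vsub_eq_sub, h, add_sub_cancel_left] at hlin
    have hmem := linear_mem_vectorSpan b (affineOfVertices b (V l)) (z - z')
    rw [hcomp, hlin] at hmem
    have hr : r = 0 := by
      by_contra hr
      exact (S.swipe (c l)).transverse ((Submodule.smul_mem_iff _ hr).1 hmem)
    exact sub_eq_zero.1 (injective_linear_of_affineIndependent b _
      (hcomp ▸ (S.swipe (c l)).start.indep) (by rw [hlin, hr, zero_smul]))
  refine ⟨{
    k := S.k
    dir := fun l => (S.swipe (c l)).dir
    pt := fun l => affineOfVertices b (V l)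
    len := fun l => affineOfVertices b (T l)
    step := hstep
    transverse := ?_ }, ⟨rfl, ?_, ?_, ?_⟩, ?_⟩
  · intro l z z' r h
    rcases le_or_gt l S.k with hl | hl
    · exact htr l hl z z' r h
    -- Past the last swipe, a point differs from the start of the last step by a multiple of the
    -- same direction, which reduces the claim to `l = S.k`.
    · have e1 : V l = V (S.k + 1) := by
        have : c l = c (S.k + 1) := Fin.ext (by simp [c]; omega)
        simp [V, if_neg (not_le.2 hl), this]
      have e2 : c l = c S.k := Fin.ext (by simp [c]; omega)
      refine htr S.k le_rfl z z'
        (affineOfVertices b (T S.k) z' + r - affineOfVertices b (T S.k) z) ?_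
      rw [e1, e2, hstep, hstep] at h
      rw [sub_smul, add_smul, ← add_sub_assoc, ← add_assoc, ← h, add_sub_cancel_right]
  · intro l
    simp [hc]
  · intro l j
    have : l.1 ≤ S.k := by omega
    simp only [affineOfVertices_vertex, V, if_pos this, hc]
  · intro l j
    simp only [affineOfVertices_vertex, hfin, hc]
  · intro z hz l
    simp only [affineOfVertices_apply]
    refine Finset.sum_nonneg fun j _ => mul_nonneg (hz j).le ?_
    simp only [T]
    split_ifs
    · exact ht _ _
    · exact le_rfl

end FromSwipes

end GeomSCD

namespace GeomSCD

/-! ### The fake snake of a separated chain family -/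

section ToSnake

variable {ι : Type*} [Fintype ι] [DecidableEq ι]
variable {E : Type*} [NormedAddCommGroup E] [NormedSpace ℝ E]

namespace ChainBundle

variable (M : ChainBundle ι E) {n : ℕ} (b : AffineBasis (Fin (n + 1)) ℝ E)

theorem pt_injective (l : ℕ) : Function.Injective (M.pt l) := fun z z' h =>
  M.transverse l z z' 0 (by simpa using h)

/-- The set is an affine image of the region between zero and an affine function over a convex base.
-/
theorem convex_chart_image {U : Set E} (hU : Convex ℝ U) (l : ℕ) :
    Convex ℝ {x | ∃ z ∈ U, ∃ u, 0 ≤ u ∧ u ≤ M.len l z ∧ x = M.chart l (z, u)} := by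
  have h : {x | ∃ z ∈ U, ∃ u, 0 ≤ u ∧ u ≤ M.len l z ∧ x = M.chart l (z, u)} =
      M.chart l '' {p | p.1 ∈ U ∧ 0 ≤ p.2 ∧ p.2 ≤ M.len l p.1} := by
    ext x
    constructor
    · rintro ⟨z, hz, u, h0, h1, rfl⟩
      exact ⟨(z, u), ⟨hz, h0, h1⟩, rfl⟩
    · rintro ⟨⟨z, u⟩, ⟨hz, h0, h1⟩, rfl⟩
      exact ⟨z, hz, u, h0, h1, rfl⟩
  rw [h]
  refine Convex.affine_image _ ?_
  rintro ⟨z, u⟩ ⟨hz, h0, h1⟩ ⟨z', u'⟩ ⟨hz', h0', h1'⟩ a c ha hc hac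
  refine ⟨hU hz hz' ha hc hac, ?_, ?_⟩
  · have := mul_nonneg ha h0
    have := mul_nonneg hc h0'
    simp only [Prod.snd_add, Prod.smul_snd, smul_eq_mul]
    linarith
  · have := mul_le_mul_of_nonneg_left h1 ha
    have := mul_le_mul_of_nonneg_left h1' hc
    simp only [Prod.smul_mk, Prod.mk_add_mk, smul_eq_mul]
    rw [Convex.combo_affine_apply hac]
    simp only [smul_eq_mul]
    linarith

/-- The open turning simplex of `M` at the `l`-th turning point. -/
def turning (l : ℕ) : PartialSimplex ι n where
  vertex := M.pt l ∘ b
  indep := b.ind.map' (M.pt l) (M.pt_injective l)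
  faces := {Finset.univ}
  univ_mem := rfl

variable (hlen : ∀ z ∈ openSimplex b, ∀ l, 0 ≤ M.len l z)

/-- The `l`-th swipe of the chains with parameters in an open simplex. -/
def toSwipe (l : ℕ) : Swipe ι n where
  dir := M.dir l
  start := M.turning b l
  finish := M.turning b (l + 1)
  transverse := by
    intro h
    change Pi.single (M.dir l) (1 : ℝ) ∈ vectorSpan ℝ (Set.range (M.pt l ∘ b)) at h
    rw [Set.range_comp, ← (M.pt l).map_vectorSpan] at h
    obtain ⟨ξ, -, hξ⟩ := h
    have h1 := (M.pt l).linearMap_vsub ξ 0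
    rw [vsub_eq_sub, sub_zero, hξ, vsub_eq_sub] at h1
    -- A parameter displacement producing the direction vector would put two parameters on one line
    -- in that direction.
    have := M.transverse l ξ 0 1 (by rw [h1]; simp)
    rw [this, sub_self] at h1
    have := congrFun h1 (M.dir l)
    simp at this
  translate := fun j => ⟨M.len l (b j),
    nonneg_vertex_of_nonneg_openSimplex b (M.len l) (fun z hz => hlen z hz l) j,
    M.step l (b j)⟩
  faces_eq := rfl
  convex := by
    convert M.convex_chart_image (convex_openSimplex b) l using 1
    ext x
    rw [M.mem_sweep_iff l (A := M.turning b l) (A' := M.turning b (l + 1)) b (fun _ => rfl)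
      (fun _ => rfl) rfl]
    simp [turning, onFace_univ]

/-- The swipe sequence of the chains with parameters in an open simplex. -/
def toSeq : SwipeSeq ι where
  d := n
  k := M.k
  swipe := fun l => M.toSwipe b hlen l
  compatible := fun _ => rfl

theorem realizes_toSeq : Realizes (M.toSeq b hlen) M b :=
  ⟨rfl, fun _ => rfl, fun _ _ => rfl, fun _ _ => rfl⟩

theorem mem_toSeq_swipe_iff (l : Fin (M.k + 1)) (x : ι → ℝ) :
    x ∈ ((M.toSeq b hlen).swipe l).carrier ↔
      ∃ z ∈ openSimplex b, ∃ u, 0 ≤ u ∧ u ≤ M.len l z ∧ x = M.chart l (z, u) := by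
  refine ((M.realizes_toSeq b hlen).mem_swipe_iff l x).trans ?_
  constructor
  · rintro ⟨B, hB, z, hz, h⟩
    obtain rfl : B = Finset.univ := hB
    exact ⟨z, (onFace_univ b z).1 hz, h⟩
  · rintro ⟨z, hz, h⟩
    exact ⟨Finset.univ, rfl, z, (onFace_univ b z).2 hz, h⟩

/-- A point with the rank of an end of its chain has only trivial steps between itself and that end,
so it lies in all their turning sets and is halted. `Realizes.not_halted` is the converse. -/
theorem mem_toSeq_trimmed_iff (l : Fin (M.k + 1)) (x : ι → ℝ) :
    x ∈ (M.toSeq b hlen).trimmed l ↔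
      ∃ z ∈ openSimplex b, (∃ u, 0 ≤ u ∧ u ≤ M.len l z ∧ x = M.chart l (z, u)) ∧
        rk (M.pt 0 z) < rk x ∧ rk x < rk (M.pt (M.k + 1) z) := by
  have R := M.realizes_toSeq b hlen
  constructor
  · rintro ⟨hx, hh⟩
    obtain ⟨z, hz, u, hu0, hu1, rfl⟩ := (M.mem_toSeq_swipe_iff b hlen l x).1 hx
    have hz' := hlen z hz
    refine ⟨z, hz, ⟨u, hu0, hu1, rfl⟩, ?_, ?_⟩
    · by_contra hle
      rw [not_lt, rk_chart] at hle
      apply hh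
      have hm := M.rk_pt_mono hz' (Nat.zero_le l)
      simp only at hm
      have hu : u = 0 := by linarith
      subst hu
      rw [M.chart_zero]
      have hpt : ∀ m ≤ l.1, M.pt m z = M.pt l z := fun m hm' =>
        (M.pt_eq_of_rk_le hz' hm' (by
          have := M.rk_pt_mono hz' (Nat.zero_le m)
          simp only at this
          linarith)).symm
      refine Or.inl ⟨fun m hm => ⟨?_, ?_⟩, R.mem_start l hz⟩
      · rw [← hpt m (le_of_lt hm)]; exact R.mem_start m hz
      · rw [← hpt (m + 1) hm]; exact R.mem_finish m hz
    · by_contra hle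
      rw [not_lt] at hle
      apply hh
      have hk : l.1 + 1 ≤ M.k + 1 := l.2
      have hm := M.rk_pt_mono hz' hk
      have hs := M.rk_pt_succ l z
      rw [rk_chart] at hle
      simp only at hm
      have hu : u = M.len l z := by linarith
      subst hu
      rw [M.chart_len]
      have hpt : ∀ m, l.1 + 1 ≤ m → m ≤ M.k + 1 → M.pt m z = M.pt (l + 1) z := fun m h1 h2 =>
        M.pt_eq_of_rk_le hz' h1 (by
          have := M.rk_pt_mono hz' h2
          simp only at this
          linarith)
      refine Or.inr ⟨fun m hm => ⟨?_, ?_⟩, R.mem_finish l hz⟩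
      · rw [← hpt m hm (le_of_lt m.2)]; exact R.mem_start m hz
      · rw [← hpt (m + 1) (Nat.le_succ_of_le hm) m.2]; exact R.mem_finish m hz
  · rintro ⟨z, hz, ⟨u, hu0, hu1, rfl⟩, h0, h1⟩
    exact R.mem_trimmed (l := l) hz hu0 hu1 h0 h1

theorem iUnion_toSeq_trimmed :
    ⋃ l, (M.toSeq b hlen).trimmed l = {x | ∃ z ∈ openSimplex b, M.Mem z x} := by
  ext x
  rw [Set.mem_iUnion]
  constructor
  · rintro ⟨l, hl⟩
    obtain ⟨z, hz, ⟨u, h⟩, h'⟩ := (M.mem_toSeq_trimmed_iff b hlen l x).1 hl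
    exact ⟨z, hz, ⟨l, Nat.le_of_lt_succ l.2, u, h⟩, h'⟩
  · rintro ⟨z, hz, ⟨l, hl, u, h⟩, h'⟩
    exact ⟨⟨l, Nat.lt_succ_of_le hl⟩, (M.mem_toSeq_trimmed_iff b hlen _ x).2 ⟨z, hz, ⟨u, h⟩, h'⟩⟩

/-- Separation puts both occurrences of `x` on one chain. Its rank is at most that of turning point
`i + 1` and at least that of `j`, so by monotonicity all turning points in between coincide with
`x`. -/
theorem fakeCondition_toSeq (hsep : M.Separates (openSimplex b)) :
    (M.toSeq b hlen).FakeCondition := by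
  have R := M.realizes_toSeq b hlen
  rintro i j hij x ⟨hi, hj⟩
  obtain ⟨z, hz, ⟨u, hu0, hu1, hxu⟩, h0, h1⟩ := (M.mem_toSeq_trimmed_iff b hlen i x).1 hi
  obtain ⟨z', hz', ⟨v, hv0, hv1, hxv⟩, h0', h1'⟩ := (M.mem_toSeq_trimmed_iff b hlen j x).1 hj
  obtain rfl : z = z' := hsep z hz z' hz' x
    ⟨⟨i, Nat.le_of_lt_succ i.2, u, hu0, hu1, hxu⟩, h0, h1⟩
    ⟨⟨j, Nat.le_of_lt_succ j.2, v, hv0, hv1, hxv⟩, h0', h1'⟩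
  have hlz := hlen z hz
  have hij' : i.1 + 1 ≤ j.1 := hij
  have hmono := M.rk_pt_mono hlz
  have e1 : rk x ≤ rk (M.pt (i + 1) z) := by rw [hxu, rk_chart, rk_pt_succ]; linarith
  have e2 : rk (M.pt j z) ≤ rk x := by rw [hxv, rk_chart]; linarith
  have hpt : ∀ m, i.1 + 1 ≤ m → m ≤ j → x = M.pt m z := by
    have hj : x = M.pt j z := by
      have := hmono hij'
      simp only at this
      have hv : v = 0 := by
        rw [hxv, rk_chart] at e1
        linarith
      rw [hxv, hv, M.chart_zero]
    intro m hm hmj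
    rw [hj]
    refine M.pt_eq_of_rk_le hlz hmj ?_
    have := hmono hm
    simp only at this
    linarith
  have hstart : ∀ l : Fin (M.k + 1), i < l → l ≤ j →
      x ∈ ((M.toSeq b hlen).swipe l).start.carrier := by
    intro l h1 h2
    rw [hpt l h1 h2]
    exact R.mem_start l hz
  have hfinish : ∀ l : Fin (M.k + 1), i ≤ l → l < j →
      x ∈ ((M.toSeq b hlen).swipe l).finish.carrier := by
    intro l h1 h2
    rw [hpt (l + 1) (Nat.succ_le_succ h1) h2]
    exact R.mem_finish l hz
  have htrim : ∀ l : Fin (M.k + 1), i < l → l < j → x ∈ (M.toSeq b hlen).trimmed l := by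
    intro l h1 h2
    refine (M.mem_toSeq_trimmed_iff b hlen l x).2 ⟨z, hz, ⟨0, le_rfl, hlz l, ?_⟩, h0, by assumption⟩
    rw [M.chart_zero]
    exact hpt l h1 (le_of_lt h2)
  exact ⟨⟨hi, hfinish i le_rfl hij⟩, ⟨hj, hstart j hij le_rfl⟩, fun l h1 h2 =>
    ⟨⟨htrim l h1 h2, hstart l h1 (le_of_lt h2)⟩, ⟨htrim l h1 h2, hfinish l (le_of_lt h1) h2⟩⟩⟩

/-- The fake snake formed by the chains with parameters in an open simplex. -/
def toSnake (hsep : M.Separates (openSimplex b)) : Snake ι :=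
  .fake (M.toSeq b hlen) (M.fakeCondition_toSeq b hlen hsep)

theorem carrier_toSnake (hsep : M.Separates (openSimplex b)) :
    (M.toSnake b hlen hsep).carrier = {x | ∃ z ∈ openSimplex b, M.Mem z x} :=
  M.iUnion_toSeq_trimmed b hlen

theorem isSymmetric_toSnake (hsep : M.Separates (openSimplex b)) {P : Set (ι → ℝ)}
    (h : M.Balanced (polytopeRank P)) : (M.toSnake b hlen hsep).IsSymmetric P :=
  fun j => h (b j)

theorem weakHyperplane_toSnake (hsep : M.Separates (openSimplex b))
    (h : M.WeakHyperplane (openSimplex b)) : (M.toSnake b hlen hsep).WeakHyperplane := by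
  intro l
  obtain ⟨a, r, h1, h2, h3⟩ := h l.1 l.2
  refine ⟨a, r, h1, ?_, h3⟩
  intro x hx
  obtain ⟨A, hA, z, hz, rfl⟩ := ((M.turning b (l.1 + 1)).mem_carrier_iff b (M.pt (l.1 + 1))
    (fun _ => rfl) x).1 hx
  obtain rfl : A = Finset.univ := hA
  exact h2 z ((onFace_univ b z).1 hz)

/-- The chart is injective, so it could fill the space only if the dimensions agreed. -/
theorem negligible_range_chart [FiniteDimensional ℝ E]
    (h : Module.finrank ℝ E + 1 ≠ Fintype.card ι) (l : ℕ) :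
    Negligible (Set.range (M.chart l)) := by
  refine Negligible.of_subspace ((⊤ : AffineSubspace ℝ (E × ℝ)).map (M.chart l)) ?_ ?_
  · intro htop
    have hs : Function.Surjective (M.chart l) := by
      intro x
      have : x ∈ (⊤ : AffineSubspace ℝ (E × ℝ)).map (M.chart l) := by
        rw [htop]; exact AffineSubspace.mem_top _ _ _
      obtain ⟨p, -, hp⟩ := AffineSubspace.mem_map.1 this
      exact ⟨p, hp⟩
    have := LinearMap.finrank_range_of_inj
      ((M.chart l).linear_injective_iff.2 (M.chart_injective l))
    rw [LinearMap.range_eq_top.2 ((M.chart l).linear_surjective_iff.2 hs)] at this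
    simp at this
    exact h this.symm
  · rintro _ ⟨p, rfl⟩
    exact AffineSubspace.mem_map_of_mem _ (AffineSubspace.mem_top _ _ _)

/-- Between spaces of equal dimension the injective chart is open, and a step of positive length
contains the image of an open set. -/
theorem interior_nonempty [FiniteDimensional ℝ E]
    (h : Module.finrank ℝ E + 1 = Fintype.card ι) {U : Set E} (hU : IsOpen U)
    (hne : U.Nonempty) (hU0 : ∀ z ∈ U, ∀ l, 0 ≤ M.len l z) {l : ℕ} (hl : l ≤ M.k)
    (hpos : ∀ z ∈ U, 0 < M.len l z) : (interior {x | ∃ z ∈ U, M.Mem z x}).Nonempty := by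
  have hopen : IsOpenMap (M.chart l) := by
    rw [← AffineMap.isOpenMap_linear_iff]
    refine LinearMap.isOpenMap_of_finiteDimensional _ ?_
    refine (LinearMap.injective_iff_surjective_of_finrank_eq_finrank (by simp [h])).1 ?_
    exact (M.chart l).linear_injective_iff.2 (M.chart_injective l)
  have ho : IsOpen {p : E × ℝ | p.1 ∈ U ∧ 0 < p.2 ∧ p.2 < M.len l p.1} := by
    have hc : Continuous (M.len l) := (M.len l).continuous_of_finiteDimensional
    exact (hU.preimage continuous_fst).inter
      ((isOpen_lt continuous_const continuous_snd).inter
        (isOpen_lt continuous_snd (hc.comp continuous_fst)))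
  obtain ⟨z, hz⟩ := hne
  refine ⟨M.chart l (z, M.len l z / 2), interior_maximal ?_ (hopen _ ho)
    ⟨_, ⟨hz, half_pos (hpos z hz), half_lt_self (hpos z hz)⟩, rfl⟩⟩
  rintro _ ⟨⟨z', u⟩, ⟨h1, h2, h3⟩, rfl⟩
  exact ⟨z', h1, M.mem_of_lt (hU0 z' h1) hl h2 h3⟩

end ChainBundle

/-- In any other dimension the snake would be covered by finitely many negligible chart ranges. -/
theorem finrank_add_one_eq_card {F : Snake ι} {M : ChainBundle ι E} [FiniteDimensional ℝ E]
    {b : AffineBasis (Fin (F.seq.d + 1)) ℝ E} (R : Realizes F.seq M b)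
    (h : (interior F.carrier).Nonempty) : Module.finrank ℝ E + 1 = Fintype.card ι := by
  by_contra hne
  have hn : Negligible F.carrier := by
    refine (Negligible.iUnion fun l : Fin (M.k + 1) => M.negligible_range_chart hne l).mono ?_
    intro x hx
    obtain ⟨l, hl, z, u, -, -, -, rfl⟩ := exists_chart_of_mem_snake R hx
    exact Set.mem_iUnion.2 ⟨⟨l, Nat.lt_succ_of_le hl⟩, _, rfl⟩
  rw [hn.interior_eq_empty] at h
  exact Set.not_nonempty_empty h

end ToSnake

end GeomSCD

namespace GeomSCD

/-! ### L-shaped chains in the product of two chain families -/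

section Product

variable {ι κ : Type*} [Fintype ι] [DecidableEq ι] [Fintype κ] [DecidableEq κ]
variable {E : Type*} [NormedAddCommGroup E] [NormedSpace ℝ E]
variable {E' : Type*} [NormedAddCommGroup E'] [NormedSpace ℝ E']

theorem rk_sumElim (x : ι → ℝ) (y : κ → ℝ) : rk (Sum.elim x y) = rk x + rk y := by
  simp [rk]

theorem sumElim_add_left (x : ι → ℝ) (y : κ → ℝ) (u : ℝ) (c : ι) :
    Sum.elim x y + u • Pi.single (Sum.inl c) (1 : ℝ) =
      Sum.elim (x + u • Pi.single c (1 : ℝ)) y := by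
  ext (a | a)
  · simp [Pi.single_apply]
  · simp

theorem sumElim_add_right (x : ι → ℝ) (y : κ → ℝ) (u : ℝ) (c : κ) :
    Sum.elim x y + u • Pi.single (Sum.inr c) (1 : ℝ) =
      Sum.elim x (y + u • Pi.single c (1 : ℝ)) := by
  ext (a | a)
  · simp
  · simp [Pi.single_apply]

theorem sumElim_inj {x x' : ι → ℝ} {y y' : κ → ℝ} (h : Sum.elim x y = Sum.elim x' y') :
    x = x' ∧ y = y' :=
  ⟨funext fun c => congrFun h (Sum.inl c), funext fun c => congrFun h (Sum.inr c)⟩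

/-- Two affine maps joined to an affine map into the product of the coordinate spaces. -/
def joinAff {F : Type*} [AddCommGroup F] [Module ℝ F] (f : F →ᵃ[ℝ] (ι → ℝ))
    (g : F →ᵃ[ℝ] (κ → ℝ)) : F →ᵃ[ℝ] (ι ⊕ κ → ℝ) :=
  (LinearEquiv.sumArrowLequivProdArrow ι κ ℝ ℝ).symm.toLinearMap.toAffineMap.comp (f.prod g)

@[simp]
theorem joinAff_apply {F : Type*} [AddCommGroup F] [Module ℝ F] (f : F →ᵃ[ℝ] (ι → ℝ))
    (g : F →ᵃ[ℝ] (κ → ℝ)) (z : F) : joinAff f g z = Sum.elim (f z) (g z) := rfl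

namespace ChainBundle

variable (M : ChainBundle ι E) (N : ChainBundle κ E')

/-- The rank of the `l`-th turning point above the starting point. -/
def height (l : ℕ) : E →ᵃ[ℝ] ℝ := rkAff.comp (M.pt l) - rkAff.comp (M.pt 0)

theorem height_apply (l : ℕ) (z : E) : M.height l z = rk (M.pt l z) - rk (M.pt 0 z) := rfl

theorem height_zero (z : E) : M.height 0 z = 0 := by simp [height_apply]

theorem height_succ (l : ℕ) (z : E) : M.height (l + 1) z = M.height l z + M.len l z := by
  rw [height_apply, height_apply, rk_pt_succ]; ring

theorem height_mono {z : E} (hz : ∀ l, 0 ≤ M.len l z) : Monotone fun l => M.height l z :=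
  monotone_nat_of_le_succ fun l => by rw [height_succ]; linarith [hz l]

/-- In the product of two chain bundles the parameter `(w, w', s)` stands for the chain that
starts at height `s` of the first and height `0` of the second chain, goes up to the height
`topHeight` in the second chain and then to the end of the first chain. -/
def topHeight (N : ChainBundle κ E') : E × E' × ℝ →ᵃ[ℝ] ℝ :=
  (N.height (N.k + 1)).comp (AffineMap.fst.comp AffineMap.snd) -
    AffineMap.snd.comp AffineMap.snd

/-- The height of the starting point above the `i`-th turning point of the first chain. -/
def startOffset (i : ℕ) : E × E' × ℝ →ᵃ[ℝ] ℝ :=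
  AffineMap.snd.comp AffineMap.snd - (M.height i).comp AffineMap.fst

theorem startOffset_apply (i : ℕ) (w : E) (w' : E') (s : ℝ) :
    M.startOffset i (w, w', s) = s - M.height i w := rfl

/-- The top height above the `j`-th turning point of the second chain. -/
def topOffset (j : ℕ) : E × E' × ℝ →ᵃ[ℝ] ℝ :=
  N.topHeight - (N.height j).comp (AffineMap.fst.comp AffineMap.snd)

theorem topOffset_apply (j : ℕ) (w : E) (w' : E') (s : ℝ) :
    N.topOffset j (w, w', s) = N.height (N.k + 1) w' - s - N.height j w' := rfl

/-- The starting point in the first chain, provided that it lies on the step `i`. -/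
def startPt (i : ℕ) : E × E' × ℝ →ᵃ[ℝ] (ι → ℝ) :=
  (M.chart i).comp (AffineMap.fst.prod (M.startOffset i))

theorem startPt_apply (i : ℕ) (w : E) (w' : E') (s : ℝ) :
    M.startPt i (w, w', s) = M.chart i (w, s - M.height i w) := rfl

/-- The top point in the second chain, provided that it lies on the step `j`. -/
def topPt (j : ℕ) : E × E' × ℝ →ᵃ[ℝ] (κ → ℝ) :=
  (N.chart j).comp ((AffineMap.fst.comp AffineMap.snd).prod (N.topOffset j))

theorem topPt_apply (j : ℕ) (w : E) (w' : E') (s : ℝ) :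
    N.topPt j (w, w', s) = N.chart j (w', N.height (N.k + 1) w' - s - N.height j w') := rfl

theorem rk_startPt (i : ℕ) (w : E) (w' : E') (s : ℝ) :
    rk (M.startPt i (w, w', s)) = rk (M.pt 0 w) + s := by
  rw [startPt_apply, rk_chart, height_apply]; ring

theorem rk_topPt (j : ℕ) (w : E) (w' : E') (s : ℝ) :
    rk (N.topPt j (w, w', s)) = rk (N.pt (N.k + 1) w') - s := by
  rw [topPt_apply, rk_chart, height_apply, height_apply]; ring

theorem chart_add (l : ℕ) (z : E) (u v : ℝ) :
    M.chart l (z, u) + v • Pi.single (M.dir l) (1 : ℝ) = M.chart l (z, u + v) := by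
  rw [chart_apply, chart_apply, add_smul, add_assoc]

/-- The turning points of the product chains. -/
def prodPt (i j l : ℕ) : E × E' × ℝ →ᵃ[ℝ] (ι ⊕ κ → ℝ) :=
  joinAff (if l ≤ j + 1 then M.startPt i else (M.pt (i + (l - (j + 1)))).comp AffineMap.fst)
    (if l ≤ j then (N.pt l).comp (AffineMap.fst.comp AffineMap.snd) else N.topPt j)

/-- The directions of the product chains. -/
def prodDir (i j l : ℕ) : ι ⊕ κ :=
  if l ≤ j then Sum.inr (N.dir l) else Sum.inl (M.dir (i + (l - (j + 1))))

/-- The step lengths of the product chains. -/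
def prodLen (i j l : ℕ) : E × E' × ℝ →ᵃ[ℝ] ℝ :=
  if l < j then (N.len l).comp (AffineMap.fst.comp AffineMap.snd)
  else if l = j then N.topOffset j
  else if l = j + 1 then - M.startOffset (i + 1)
  else (M.len (i + (l - (j + 1)))).comp AffineMap.fst

variable {i j : ℕ} {w : E} {w' : E'} {s : ℝ}

theorem prodPt_of_le {l : ℕ} (h : l ≤ j) : M.prodPt N i j l (w, w', s) =
    Sum.elim (M.startPt i (w, w', s)) (N.pt l w') := by
  simp [prodPt, h, Nat.le_succ_of_le h]

theorem prodPt_corner : M.prodPt N i j (j + 1) (w, w', s) =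
    Sum.elim (M.startPt i (w, w', s)) (N.topPt j (w, w', s)) := by
  simp [prodPt]

theorem prodPt_of_gt (r : ℕ) : M.prodPt N i j (j + 1 + (r + 1)) (w, w', s) =
    Sum.elim (M.pt (i + (r + 1)) w) (N.topPt j (w, w', s)) := by
  have h1 : ¬ j + 1 + (r + 1) ≤ j + 1 := by omega
  have h2 : ¬ j + 1 + (r + 1) ≤ j := by omega
  simp [prodPt, h1, h2]

theorem prodDir_of_le {l : ℕ} (h : l ≤ j) : M.prodDir N i j l = Sum.inr (N.dir l) := by
  simp [prodDir, h]

theorem prodDir_of_gt (r : ℕ) : M.prodDir N i j (j + 1 + r) = Sum.inl (M.dir (i + r)) := by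
  have h2 : ¬ j + 1 + r ≤ j := by omega
  simp [prodDir, h2]

theorem prodLen_of_lt {l : ℕ} (h : l < j) : M.prodLen N i j l (w, w', s) = N.len l w' := by
  simp [prodLen, h]

theorem prodLen_top : M.prodLen N i j j (w, w', s) =
    N.height (N.k + 1) w' - s - N.height j w' := by
  simp [prodLen, topOffset_apply]

theorem prodLen_corner : M.prodLen N i j (j + 1) (w, w', s) = M.height (i + 1) w - s := by
  simp [prodLen, startOffset_apply]

theorem prodLen_of_gt (r : ℕ) : M.prodLen N i j (j + 1 + (r + 1)) (w, w', s) =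
    M.len (i + (r + 1)) w := by
  have h1 : ¬ j + 1 + (r + 1) < j := by omega
  have h2 : ¬ j + 1 + (r + 1) = j := by omega
  simp [prodLen, h1, h2]

/-- The product of two chain bundles, on the parameters for which the starting point lies on
the step `i` of the first and the top point on the step `j` of the second chain. -/
def prod (i j : ℕ) : ChainBundle (ι ⊕ κ) (E × E' × ℝ) where
  -- The steps `0, …, j` of the second factor are followed by the steps `i, …, M.k` of the first;
  -- `k` is one less than the number of steps.
  k := j + 1 + (M.k - i)
  dir := M.prodDir N i j
  pt := M.prodPt N i j
  len := M.prodLen N i j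
  step := by
    rintro l ⟨w, w', s⟩
    rcases lt_trichotomy l j with h | rfl | h
    · rw [M.prodPt_of_le N h, M.prodPt_of_le N h.le, M.prodDir_of_le N h.le,
        M.prodLen_of_lt N h, sumElim_add_right, N.step]
    · rw [M.prodPt_corner N, M.prodPt_of_le N le_rfl, M.prodDir_of_le N le_rfl,
        M.prodLen_top N, sumElim_add_right, topPt_apply, chart_apply]
    · obtain ⟨r, rfl⟩ := Nat.exists_eq_add_of_le (Nat.succ_le_of_lt h)
      simp only [Nat.succ_eq_add_one]
      rw [prodDir_of_gt]
      rcases r with _ | r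
      · rw [add_assoc (j + 1) 0 1, prodPt_of_gt, add_zero, M.prodPt_corner N,
          M.prodLen_corner N, sumElim_add_left, startPt_apply, add_zero, chart_add, height_succ,
          zero_add, ← chart_len]
        congr 3
        ring
      · rw [add_assoc (j + 1), prodPt_of_gt, M.prodPt_of_gt N, M.prodLen_of_gt N,
          sumElim_add_left, ← M.step]
        rfl
  transverse := by
    rintro l ⟨w, w', s⟩ ⟨v, v', t⟩ r h
    rcases le_or_gt l j with hl | hl
    -- On the first leg the fixed starting point determines `w` and `s`; from the corner on, the
    -- fixed top point determines `w'` and `s`. Transversality in the moving factor gives the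
    -- remaining parameter.
    · rw [M.prodPt_of_le N hl, M.prodPt_of_le N hl, M.prodDir_of_le N hl,
        sumElim_add_right, startPt_apply, startPt_apply] at h
      obtain ⟨h1, h2⟩ := sumElim_inj h
      obtain ⟨rfl, h3⟩ := M.chart_inj h1
      obtain rfl := N.transverse _ _ _ _ h2
      obtain rfl : s = t := by linarith
      rfl
    · obtain ⟨m, rfl⟩ := Nat.exists_eq_add_of_le (Nat.succ_le_of_lt hl)
      simp only [Nat.succ_eq_add_one] at h
      rw [prodDir_of_gt] at h
      rcases m with _ | m
      · rw [add_zero, M.prodPt_corner N, M.prodPt_corner N, sumElim_add_left,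
          topPt_apply, topPt_apply] at h
        obtain ⟨h1, h2⟩ := sumElim_inj h
        obtain ⟨rfl, h3⟩ := N.chart_inj h2
        obtain rfl : s = t := by linarith
        rw [startPt_apply, startPt_apply, add_zero, chart_add] at h1
        obtain ⟨rfl, -⟩ := M.chart_inj h1
        rfl
      · rw [M.prodPt_of_gt N, M.prodPt_of_gt N, sumElim_add_left, topPt_apply, topPt_apply] at h
        obtain ⟨h1, h2⟩ := sumElim_inj h
        obtain ⟨rfl, h3⟩ := N.chart_inj h2
        obtain rfl : s = t := by linarith
        obtain rfl := M.transverse _ _ _ _ h1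
        rfl

theorem prod_chart_of_le {l : ℕ} (h : l ≤ j) (u : ℝ) : (M.prod N i j).chart l ((w, w', s), u) =
    Sum.elim (M.startPt i (w, w', s)) (N.chart l (w', u)) := by
  rw [chart_apply]
  change M.prodPt N i j l (w, w', s) + u • Pi.single (M.prodDir N i j l) 1 = _
  rw [M.prodPt_of_le N h, M.prodDir_of_le N h, sumElim_add_right, chart_apply]

theorem prod_chart_corner (u : ℝ) : (M.prod N i j).chart (j + 1) ((w, w', s), u) =
    Sum.elim (M.chart i (w, s - M.height i w + u)) (N.topPt j (w, w', s)) := by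
  rw [chart_apply]
  change M.prodPt N i j (j + 1) (w, w', s) + u • Pi.single (M.prodDir N i j (j + 1)) 1 = _
  have := M.prodDir_of_gt N (i := i) (j := j) 0
  rw [add_zero, add_zero] at this
  rw [M.prodPt_corner N, this, sumElim_add_left, startPt_apply, chart_add]

theorem prod_chart_of_gt (r : ℕ) (u : ℝ) :
    (M.prod N i j).chart (j + 1 + (r + 1)) ((w, w', s), u) =
      Sum.elim (M.chart (i + (r + 1)) (w, u)) (N.topPt j (w, w', s)) := by
  rw [chart_apply]
  change M.prodPt N i j (j + 1 + (r + 1)) (w, w', s) +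
    u • Pi.single (M.prodDir N i j (j + 1 + (r + 1))) 1 = _
  rw [M.prodPt_of_gt N, M.prodDir_of_gt N, sumElim_add_left, chart_apply]

theorem prod_balanced (hi : i ≤ M.k) {r r' : ℝ} (h : M.Balanced r) (h' : N.Balanced r') :
    (M.prod N i j).Balanced (r + r') := by
  rintro ⟨w, w', s⟩
  have e1 : (M.prod N i j).pt 0 (w, w', s) = _ := M.prodPt_of_le N (Nat.zero_le j)
  have e2 : (M.prod N i j).pt ((M.prod N i j).k + 1) (w, w', s) = _ :=
    M.prodPt_of_gt N (i := i) (j := j) (M.k - i)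
  rw [e1, e2, rk_sumElim, rk_sumElim, rk_startPt, rk_topPt,
    show i + (M.k - i + 1) = M.k + 1 by omega, ← h w, ← h' w']
  ring

/-- The linear part of the injective chart has a left inverse, so a linear functional of the
parameters extends to the ambient space. The chart sends the unit vector of `u` to the direction of
the step, which gives the coefficient one. -/
theorem exists_functional (i : ℕ) (f₀ : E →ᵃ[ℝ] ℝ) : ∃ a : ι → ℝ, a (M.dir i) = 1 ∧ ∃ r,
    ∀ w u, ∑ c, a c * M.chart i (w, u) c = f₀ w + u + r := by
  obtain ⟨g, hg⟩ := LinearMap.exists_leftInverse_of_injective (M.chart i).linear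
    (LinearMap.ker_eq_bot.2 ((M.chart i).linear_injective_iff.2 (M.chart_injective i)))
  let f : (ι → ℝ) →ₗ[ℝ] ℝ :=
    (f₀.linear.comp (LinearMap.fst ℝ E ℝ) + LinearMap.snd ℝ E ℝ).comp g
  have hf : ∀ x : ι → ℝ, ∑ c, f (Pi.single c 1) * x c = f x := by
    intro x
    conv_rhs => rw [← Finset.univ_sum_single x]
    rw [map_sum]
    refine Finset.sum_congr rfl fun c _ => ?_
    have : Pi.single c (x c) = x c • (Pi.single c (1 : ℝ) : ι → ℝ) := by
      rw [← Pi.single_smul, smul_eq_mul, mul_one]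
    rw [this, map_smul, smul_eq_mul, mul_comm]
  have hlin : ∀ w u, f ((M.chart i).linear (w, u)) = f₀.linear w + u := by
    intro w u
    have : g ((M.chart i).linear (w, u)) = (w, u) := LinearMap.congr_fun hg (w, u)
    simp [f, this]
  have hdiff : ∀ w u, (M.chart i).linear (w, u) = M.chart i (w, u) - M.chart i (0, 0) := by
    intro w u
    have := (M.chart i).linearMap_vsub (w, u) (0, 0)
    simpa using this
  refine ⟨fun c => f (Pi.single c 1), ?_, f (M.chart i (0, 0)) - f₀ 0, fun w u => ?_⟩
  · have h1 : (M.chart i).linear (0, 1) = Pi.single (M.dir i) 1 := by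
      rw [hdiff, chart_apply, chart_apply]; simp
    have := hlin 0 1
    rw [h1] at this
    simpa using this
  · rw [hf]
    have h1 := hlin w u
    rw [hdiff, map_sub] at h1
    have h2 := f₀.linearMap_vsub w 0
    simp only [vsub_eq_sub, sub_zero] at h2
    rw [h2] at h1
    linarith

theorem prod_weakHyperplane (hi : i ≤ M.k) (hj : j ≤ N.k) {U : Set E} {U' : Set E'}
    (h : M.WeakHyperplane U) (h' : N.WeakHyperplane U') {W : Set (E × E' × ℝ)}
    (hW : ∀ z ∈ W, z.1 ∈ U ∧ z.2.1 ∈ U') : (M.prod N i j).WeakHyperplane W := by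
  intro l hl
  change l < j + 1 + (M.k - i) at hl
  change ∃ (a : ι ⊕ κ → ℝ) (r : ℝ), a ≠ 0 ∧
    (∀ z ∈ W, ∑ c, a c * M.prodPt N i j (l + 1) z c = r) ∧
    a (M.prodDir N i j l) = a (M.prodDir N i j (l + 1))
  rcases lt_trichotomy l j with hlj | rfl | hlj
  · obtain ⟨a, r, ha, har, had⟩ := h' l (by omega)
    refine ⟨Sum.elim 0 a, r, ?_, ?_, ?_⟩
    · intro h0
      exact ha (funext fun c => congrFun h0 (Sum.inr c))
    · rintro ⟨w, w', s⟩ hz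
      rw [M.prodPt_of_le N hlj]
      simpa using har w' (hW _ hz).2
    · rw [M.prodDir_of_le N hlj, M.prodDir_of_le N hlj.le]
      exact had
  -- At the corner the first functional takes the value `s + r` and the second `-s + r'`, so their
  -- sum is constant.
  · obtain ⟨a, ha, r, har⟩ := M.exists_functional i (M.height i)
    obtain ⟨a', ha', r', har'⟩ := N.exists_functional l (N.height l - N.height (N.k + 1))
    have hdir := M.prodDir_of_gt N (i := i) (j := l) 0
    rw [add_zero, add_zero] at hdir
    refine ⟨Sum.elim a a', r + r', ?_, ?_, ?_⟩
    · intro h0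
      have := congrFun h0 (Sum.inl (M.dir i))
      simp [ha] at this
    · rintro ⟨w, w', s⟩ -
      rw [M.prodPt_corner N, startPt_apply, topPt_apply, Fintype.sum_sum_type]
      simp only [Sum.elim_inl, Sum.elim_inr]
      rw [har, har']
      simp only [AffineMap.coe_sub, Pi.sub_apply]
      ring
    · rw [hdir, M.prodDir_of_le N le_rfl]
      simp [ha, ha']
  · obtain ⟨m, rfl⟩ := Nat.exists_eq_add_of_le (Nat.succ_le_of_lt hlj)
    simp only [Nat.succ_eq_add_one] at hl ⊢
    obtain ⟨a, r, ha, har, had⟩ := h (i + m) (by omega)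
    refine ⟨Sum.elim a 0, r, ?_, ?_, ?_⟩
    · intro h0
      exact ha (funext fun c => congrFun h0 (Sum.inl c))
    · rintro ⟨w, w', s⟩ hz
      rw [add_assoc, M.prodPt_of_gt N]
      simpa [add_assoc] using har w (hW _ hz).1
    · rw [add_assoc (j + 1), M.prodDir_of_gt N, M.prodDir_of_gt N]
      exact had

end ChainBundle

end Product

end GeomSCD

/-! ### Cells of constant combinatorial type; separation and covering -/

namespace GeomSCD

theorem exists_step_of_lt {f : ℕ → ℝ} {s : ℝ} {n : ℕ} (h0 : f 0 < s) (hn : s < f n)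
    (hne : ∀ i ≤ n, f i ≠ s) : ∃ i < n, f i < s ∧ s < f (i + 1) := by
  induction n with
  | zero => exact absurd (h0.trans hn) (lt_irrefl _)
  | succ n ih =>
    rcases lt_or_ge s (f n) with h | h
    · obtain ⟨i, hi, h⟩ := ih h fun i hi => hne i (by omega)
      exact ⟨i, by omega, h⟩
    · exact ⟨n, by omega, lt_of_le_of_ne h (hne n (by omega)), hn⟩

/-- Compares the steps of a chain that contain two given heights; with `s = t`, used in both
directions, it shows that the step is unique. -/
theorem Monotone.index_le {f : ℕ → ℝ} (hf : Monotone f) {s t : ℝ} {i j : ℕ} (hi : f i < s)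
    (hst : s ≤ t) (hj : t < f (j + 1)) : i ≤ j := by
  by_contra h
  have := hf (show j + 1 ≤ i by omega)
  linarith

section Cells

variable {ι κ : Type*} [Fintype ι] [DecidableEq ι] [Fintype κ] [DecidableEq κ]
variable {E : Type*} [NormedAddCommGroup E] [NormedSpace ℝ E]
variable {E' : Type*} [NormedAddCommGroup E'] [NormedSpace ℝ E']

namespace ChainBundle

variable (M : ChainBundle ι E) (N : ChainBundle κ E') (U : Set E) (U' : Set E')

/-- The parameters of the product chains with starting point on the step `i` of the first and
top point on the step `j` of the second chain. -/
def cell (i j : ℕ) : Set (E × E' × ℝ) :=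
  {z | z.1 ∈ U ∧ z.2.1 ∈ U' ∧ M.height i z.1 < z.2.2 ∧ z.2.2 < M.height (i + 1) z.1 ∧
    N.height j z.2.1 < N.height (N.k + 1) z.2.1 - z.2.2 ∧
    N.height (N.k + 1) z.2.1 - z.2.2 < N.height (j + 1) z.2.1}

variable {U U'}

theorem prod_len_nonneg (hM : ∀ z ∈ U, ∀ l, 0 ≤ M.len l z) (hN : ∀ z ∈ U', ∀ l, 0 ≤ N.len l z)
    {i j : ℕ} {z : E × E' × ℝ} (hz : z ∈ M.cell N U U' i j) (l : ℕ) :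
    0 ≤ (M.prod N i j).len l z := by
  obtain ⟨w, w', s⟩ := z
  obtain ⟨h1, h2, h3, h4, h5, h6⟩ := hz
  simp only at h1 h2 h3 h4 h5 h6
  change 0 ≤ M.prodLen N i j l (w, w', s)
  rcases lt_trichotomy l j with h | rfl | h
  · rw [M.prodLen_of_lt N h]; exact hN _ h2 l
  · rw [M.prodLen_top N]; linarith
  · obtain ⟨r, rfl⟩ := Nat.exists_eq_add_of_le (Nat.succ_le_of_lt h)
    rcases r with _ | r
    · simp only [Nat.succ_eq_add_one, add_zero]
      rw [M.prodLen_corner N]; linarith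
    · simp only [Nat.succ_eq_add_one]
      rw [M.prodLen_of_gt N]; exact hM _ h1 _

theorem cell_index_unique (hM : ∀ z ∈ U, ∀ l, 0 ≤ M.len l z)
    (hN : ∀ z ∈ U', ∀ l, 0 ≤ N.len l z) {i j i' j' : ℕ} {z : E × E' × ℝ}
    (hz : z ∈ M.cell N U U' i j) (hz' : z ∈ M.cell N U U' i' j') : i = i' ∧ j = j' := by
  obtain ⟨h1, h2, h3, h4, h5, h6⟩ := hz
  obtain ⟨-, -, h3', h4', h5', h6'⟩ := hz'
  have m := M.height_mono (hM _ h1)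
  have n := N.height_mono (hN _ h2)
  exact ⟨le_antisymm (Monotone.index_le m h3 le_rfl h4') (Monotone.index_le m h3' le_rfl h4),
    le_antisymm (Monotone.index_le n h5 le_rfl h6') (Monotone.index_le n h5' le_rfl h6)⟩

/-- A point of a product chain lies on both factor chains, and determines the third parameter. -/
theorem mem_of_prod_mem (hM : ∀ z ∈ U, ∀ l, 0 ≤ M.len l z)
    (hN : ∀ z ∈ U', ∀ l, 0 ≤ N.len l z) {i j : ℕ} (hi : i ≤ M.k) (hj : j ≤ N.k) {w : E} {w' : E'}
    {s : ℝ} (hz : (w, w', s) ∈ M.cell N U U' i j) {x : ι → ℝ} {y : κ → ℝ}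
    (h : (M.prod N i j).Mem (w, w', s) (Sum.elim x y)) :
    M.Mem w x ∧ N.Mem w' y ∧
      s = min (rk x - rk (M.pt 0 w)) (rk (N.pt (N.k + 1) w') - rk y) := by
  obtain ⟨⟨l, hl, u, hu0, hu1, hx⟩, hlo, hhi⟩ := h
  obtain ⟨h1, h2, h3, h4, h5, h6⟩ := hz
  simp only at h1 h2 h3 h4 h5 h6
  have hlM := hM w h1
  have hlN := hN w' h2
  have mM := M.height_mono hlM
  have mN := N.height_mono hlN
  change l ≤ j + 1 + (M.k - i) at hl
  change u ≤ M.prodLen N i j l (w, w', s) at hu1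
  change rk (M.prodPt N i j 0 (w, w', s)) < _ at hlo
  change _ < rk (M.prodPt N i j (j + 1 + (M.k - i + 1)) (w, w', s)) at hhi
  rw [M.prodPt_of_le N (Nat.zero_le j), rk_sumElim, rk_sumElim, rk_startPt] at hlo
  rw [M.prodPt_of_gt N, rk_sumElim, rk_sumElim, rk_topPt,
    show i + (M.k - i + 1) = M.k + 1 by omega] at hhi
  have hs0 : 0 < s := by
    have := mM (Nat.zero_le i)
    simp only [height_zero] at this
    linarith
  have hstart : M.Mem w (M.startPt i (w, w', s)) := by
    rw [startPt_apply]
    exact M.mem_of_lt hlM hi (by linarith) (by rw [M.height_succ i] at h4; linarith)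
  have htop : N.Mem w' (N.topPt j (w, w', s)) := by
    rw [topPt_apply]
    exact N.mem_of_lt hlN hj (by linarith) (by rw [N.height_succ j] at h6; linarith)
  rcases le_or_gt l j with hlj | hlj
  · rw [M.prod_chart_of_le N hlj] at hx
    obtain ⟨rfl, rfl⟩ := sumElim_inj hx
    have hr := M.rk_startPt (E' := E') i w w' s
    -- On the first leg `x` sits at height `s` and `y` is not above the top, so the minimum is
    -- attained by the term of `x`.
    have hle : u ≤ N.len l w' ∧ rk (N.pt l w') + u ≤ rk (N.pt (N.k + 1) w') - s := by
      rcases hlj.lt_or_eq with h | rfl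
      · rw [M.prodLen_of_lt N h] at hu1
        refine ⟨hu1, ?_⟩
        have := mN (Nat.succ_le_of_lt h)
        simp only [Nat.succ_eq_add_one, height_succ] at this
        simp only [height_apply] at this h5
        linarith
      · rw [M.prodLen_top N] at hu1
        rw [N.height_succ l] at h6
        refine ⟨by linarith, ?_⟩
        simp only [height_apply] at hu1
        linarith
    rw [rk_chart] at hlo
    refine ⟨hstart, ⟨⟨l, by omega, u, hu0, hle.1, rfl⟩, ?_, ?_⟩, ?_⟩
    · rw [rk_chart]; linarith
    · rw [rk_chart]; linarith
    · rw [hr, rk_chart, min_eq_left (by linarith)]; ring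
  · obtain ⟨r, rfl⟩ := Nat.exists_eq_add_of_le (Nat.succ_le_of_lt hlj)
    simp only [Nat.succ_eq_add_one] at hl hu1 hx
    have hr := N.rk_topPt (E := E) j w w' s
    -- On the second leg `y` is the top point and `x` has height at least `s`, so the minimum is
    -- attained by the term of `y`.
    have key : y = N.topPt j (w, w', s) ∧ ∃ v, 0 ≤ v ∧ v ≤ M.len (i + r) w ∧
        x = M.chart (i + r) (w, v) ∧ s ≤ rk x - rk (M.pt 0 w) := by
      rcases r with _ | r
      · simp only [add_zero] at hx hu1
        rw [M.prod_chart_corner N] at hx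
        obtain ⟨rfl, rfl⟩ := sumElim_inj hx
        rw [M.prodLen_corner N, height_succ] at hu1
        refine ⟨rfl, _, ?_, ?_, rfl, ?_⟩
        · linarith
        · rw [add_zero]; linarith
        · rw [rk_chart, height_apply]; linarith
      · rw [M.prod_chart_of_gt N] at hx
        rw [M.prodLen_of_gt N] at hu1
        obtain ⟨rfl, rfl⟩ := sumElim_inj hx
        refine ⟨rfl, u, hu0, hu1, rfl, ?_⟩
        have := mM (show i + 1 ≤ i + (r + 1) by omega)
        simp only at this
        rw [rk_chart]
        have e := M.height_apply (i + (r + 1)) w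
        linarith
    obtain ⟨rfl, v, hv0, hv1, hxv, hsx⟩ := key
    refine ⟨⟨⟨i + r, by omega, v, hv0, hv1, hxv⟩, by linarith, by linarith⟩, htop, ?_⟩
    rw [hr, min_eq_right (by linarith)]; ring

/-- The point determines both factor chains by their separation, and then `s` by the formula with
the minimum. Allowing different cells makes this serve for disjointness of different snakes as well
as for the snake condition. -/
theorem prod_separates (hM : ∀ z ∈ U, ∀ l, 0 ≤ M.len l z)
    (hN : ∀ z ∈ U', ∀ l, 0 ≤ N.len l z) (sM : M.Separates U) (sN : N.Separates U')
    {i j i' j' : ℕ} (hi : i ≤ M.k) (hj : j ≤ N.k) (hi' : i' ≤ M.k) (hj' : j' ≤ N.k)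
    {z z' : E × E' × ℝ} (hz : z ∈ M.cell N U U' i j) (hz' : z' ∈ M.cell N U U' i' j')
    {p : ι ⊕ κ → ℝ} (hp : (M.prod N i j).Mem z p) (hp' : (M.prod N i' j').Mem z' p) :
    z = z' := by
  obtain ⟨w, w', s⟩ := z
  obtain ⟨v, v', t⟩ := z'
  rw [← Sum.elim_comp_inl_inr p] at hp hp'
  obtain ⟨a1, a2, a3⟩ := M.mem_of_prod_mem N hM hN hi hj hz hp
  obtain ⟨b1, b2, b3⟩ := M.mem_of_prod_mem N hM hN hi' hj' hz' hp'
  obtain rfl := sM w hz.1 v hz'.1 _ a1 b1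
  obtain rfl := sN w' hz.2.1 v' hz'.2.1 _ a2 b2
  rw [a3, b3]

/-- The chart of the product of two steps. -/
def pairChart (l l' : ℕ) : (E × ℝ) × (E' × ℝ) →ᵃ[ℝ] (ι ⊕ κ → ℝ) :=
  joinAff ((M.chart l).comp AffineMap.fst) ((N.chart l').comp AffineMap.snd)

theorem pairChart_apply (l l' : ℕ) (p : E × ℝ) (q : E' × ℝ) :
    M.pairChart N l l' (p, q) = Sum.elim (M.chart l p) (N.chart l' q) := rfl

theorem pairChart_injective (l l' : ℕ) : Function.Injective (M.pairChart N l l') := by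
  rintro ⟨p, q⟩ ⟨p', q'⟩ h
  rw [pairChart_apply, pairChart_apply] at h
  obtain ⟨h1, h2⟩ := sumElim_inj h
  rw [M.chart_injective l h1, N.chart_injective l' h2]

/-- The parameter of the product chain through a point, if the point lies above its start. -/
def lowerParam (l : ℕ) : (E × ℝ) × (E' × ℝ) →ᵃ[ℝ] E × E' × ℝ :=
  let p : (E × ℝ) × (E' × ℝ) →ᵃ[ℝ] E × ℝ := AffineMap.fst
  let q : (E × ℝ) × (E' × ℝ) →ᵃ[ℝ] E' × ℝ := AffineMap.snd
  (AffineMap.fst.comp p).prod ((AffineMap.fst.comp q).prod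
    ((M.height l).comp (AffineMap.fst.comp p) + AffineMap.snd.comp p))

theorem lowerParam_apply (l : ℕ) (z : E) (u : ℝ) (z' : E') (u' : ℝ) :
    M.lowerParam (E' := E') l ((z, u), (z', u')) = (z, z', M.height l z + u) := rfl

theorem lowerParam_surjective (l : ℕ) :
    Function.Surjective (M.lowerParam (E' := E') l) := by
  rintro ⟨w, w', s⟩
  exact ⟨((w, s - M.height l w), (w', 0)), by rw [lowerParam_apply]; simp⟩

/-- The parameter of the product chain through a point, if the point lies beside its top. -/
def upperParam (l' : ℕ) : (E × ℝ) × (E' × ℝ) →ᵃ[ℝ] E × E' × ℝ :=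
  (AffineMap.fst.comp AffineMap.fst).prod ((AffineMap.fst.comp AffineMap.snd).prod
    ((N.height (N.k + 1) - N.height l').comp (AffineMap.fst.comp AffineMap.snd) -
      AffineMap.snd.comp AffineMap.snd))

theorem upperParam_apply (l' : ℕ) (z : E) (u : ℝ) (z' : E') (u' : ℝ) :
    N.upperParam l' ((z, u), (z', u')) =
      (z, z', N.height (N.k + 1) z' - N.height l' z' - u') := rfl

theorem upperParam_surjective (l' : ℕ) :
    Function.Surjective (N.upperParam l' : (E × ℝ) × (E' × ℝ) → E × E' × ℝ) := by
  rintro ⟨w, w', s⟩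
  exact ⟨((w, 0), (w', N.height (N.k + 1) w' - N.height l' w' - s)), by
    rw [upperParam_apply]; simp⟩

/-- The chart points outside of the open step over an open simplex. -/
def degenerate {n : ℕ} (b : AffineBasis (Fin (n + 1)) ℝ E) (l : ℕ) : Set (E × ℝ) :=
  (⋃ j, {p | b.coord j p.1 = 0}) ∪ ({p | p.2 = 0} ∪ {p | M.len l p.1 - p.2 = 0})

theorem negligible_degenerate {n : ℕ} (b : AffineBasis (Fin (n + 1)) ℝ E) (l : ℕ) :
    Negligible (M.degenerate b l) := by
  refine (Negligible.iUnion fun j => ?_).union (Negligible.union ?_ ?_)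
  · exact Negligible.zeros_fst (b.coord j) (x := b j) (by rw [b.coord_apply_eq]; exact one_ne_zero)
  · exact Negligible.zeros (AffineMap.snd : E × ℝ →ᵃ[ℝ] ℝ) (x := (0, 1)) (by simp)
  · exact Negligible.zeros ((M.len l).comp AffineMap.fst - AffineMap.snd)
      (x := (0, M.len l 0 + 1)) (by simp)

theorem lt_of_not_degenerate {n : ℕ} {b : AffineBasis (Fin (n + 1)) ℝ E} {l : ℕ} {z : E} {u : ℝ}
    (h : (z, u) ∉ M.degenerate b l) (hz : ∀ j, 0 ≤ b.coord j z) (h0 : 0 ≤ u)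
    (h1 : u ≤ M.len l z) : z ∈ openSimplex b ∧ 0 < u ∧ u < M.len l z := by
  simp only [degenerate, Set.mem_union, Set.mem_iUnion, Set.mem_ofPred_eq, not_or,
    not_exists] at h
  refine ⟨fun j => lt_of_le_of_ne (hz j) (Ne.symm (h.1 j)), lt_of_le_of_ne h0 (Ne.symm h.2.1),
    lt_of_le_of_ne h1 fun e => h.2.2 ?_⟩
  rw [e, sub_self]

variable (U U') in
/-- The parameters that lie on a wall between two cells or are missed by the families `C`. -/
def exceptional (C : ℕ → ℕ → Set (Set (E × E' × ℝ))) : Set (E × E' × ℝ) :=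
  (⋃ i : Fin (M.k + 2), {z | M.startOffset i z = 0}) ∪
    ((⋃ j : Fin (N.k + 2), {z | N.topOffset j z = 0}) ∪
      ⋃ i : Fin (M.k + 1), ⋃ j : Fin (N.k + 1), (M.cell N U U' i j \ ⋃₀ C i j))

theorem negligible_exceptional {C : ℕ → ℕ → Set (Set (E × E' × ℝ))}
    (hC : ∀ i ≤ M.k, ∀ j ≤ N.k, Negligible (M.cell N U U' i j \ ⋃₀ C i j)) :
    Negligible (M.exceptional N U U' C) := by
  refine (Negligible.iUnion fun i => ?_).union ((Negligible.iUnion fun j => ?_).union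
    (Negligible.iUnion fun i => Negligible.iUnion fun j => hC i (by omega) j (by omega)))
  -- The witnesses here and below are chosen so that the offset equals one.
  · exact Negligible.zeros (M.startOffset i) (x := (0, 0, M.height i 0 + 1))
      (by rw [startOffset_apply]; simp)
  · refine Negligible.zeros (N.topOffset j)
      (x := (0, 0, N.height (N.k + 1) 0 - N.height j 0 - 1)) ?_
    rw [topOffset_apply]
    ring_nf
    exact one_ne_zero

/-- A parameter outside of the exceptional set lies in a cell and is not missed. -/
theorem exists_cell_of_not_exceptional {C : ℕ → ℕ → Set (Set (E × E' × ℝ))} {w : E} {w' : E'}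
    {s : ℝ} (hw : w ∈ U) (hw' : w' ∈ U') (h0 : 0 < s) (hs : s < M.height (M.k + 1) w)
    (hs' : s < N.height (N.k + 1) w') (h : (w, w', s) ∉ M.exceptional N U U' C) :
    ∃ i ≤ M.k, ∃ j ≤ N.k, (w, w', s) ∈ M.cell N U U' i j ∧
      ∃ T ∈ C i j, (w, w', s) ∈ T := by
  simp only [exceptional, Set.mem_union, Set.mem_iUnion, Set.mem_ofPred_eq, not_or,
    not_exists, startOffset_apply, topOffset_apply] at h
  obtain ⟨e1, e2, e3⟩ := h
  obtain ⟨i, hi, hi1, hi2⟩ := exists_step_of_lt (f := fun l => M.height l w) (s := s)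
    (n := M.k + 1) (by rw [height_zero]; exact h0) hs
    (fun i hi e => e1 ⟨i, by omega⟩ (by simp [e]))
  obtain ⟨j, hj, hj1, hj2⟩ := exists_step_of_lt (f := fun l => N.height l w')
    (s := N.height (N.k + 1) w' - s) (n := N.k + 1) (by rw [height_zero]; linarith) (by linarith)
    (fun i hi e => e2 ⟨i, by omega⟩ (by simp [e]))
  have hc : (w, w', s) ∈ M.cell N U U' i j := ⟨hw, hw', hi1, hi2, hj1, hj2⟩
  refine ⟨i, by omega, j, by omega, hc, ?_⟩
  have := e3 ⟨i, hi⟩ ⟨j, hj⟩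
  by_contra hne
  exact this ⟨hc, fun ⟨T, hT, hm⟩ => hne ⟨T, hT, hm⟩⟩

/-- For a point at heights `a` and `c`, the chain through it has parameter `H' - c` if this is below
`a`, and parameter `a` if `a` is below it. `upperParam` and `lowerParam` are these two candidates;
excluding equality and the exceptional set keeps the point inside a step and the parameter inside a
piece. -/
theorem exists_prod_mem (hM : ∀ z ∈ U, ∀ l, 0 ≤ M.len l z)
    (hN : ∀ z ∈ U', ∀ l, 0 ≤ N.len l z) {C : ℕ → ℕ → Set (Set (E × E' × ℝ))} {l l' : ℕ}
    (hl : l ≤ M.k) (hl' : l' ≤ N.k) {w : E} {w' : E'} (hw : w ∈ U) (hw' : w' ∈ U') {u u' : ℝ}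
    (hu0 : 0 < u) (hu1 : u < M.len l w) (hu0' : 0 < u') (hu1' : u' < N.len l' w')
    (hne : N.height (N.k + 1) w' - N.height l' w' - u' ≠ M.height l w + u)
    (h1 : M.lowerParam (E' := E') l ((w, u), (w', u')) ∉ M.exceptional N U U' C)
    (h2 : N.upperParam l' ((w, u), (w', u')) ∉ M.exceptional N U U' C) :
    ∃ i ≤ M.k, ∃ j ≤ N.k, ∃ T ∈ C i j, ∃ z ∈ T, z ∈ M.cell N U U' i j ∧
      (M.prod N i j).Mem z (M.pairChart N l l' ((w, u), (w', u'))) := by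
  have mM := M.height_mono (hM w hw)
  have mN := N.height_mono (hN w' hw')
  have a0 := mM (Nat.zero_le l)
  have a1 := mM (show l + 1 ≤ M.k + 1 by omega)
  have b0 := mN (Nat.zero_le l')
  have b1 := mN (show l' + 1 ≤ N.k + 1 by omega)
  simp only [height_zero, height_succ] at a0 a1 b0 b1
  have aS := M.height_succ l w
  have bS := N.height_succ l' w'
  have aK := M.height_succ M.k w
  have bK := N.height_succ N.k w'
  rw [lowerParam_apply] at h1
  rw [upperParam_apply] at h2
  rcases lt_or_gt_of_ne hne with hlt | hlt
  · obtain ⟨i, hi, j, hj, hc, T, hT, hzT⟩ := M.exists_cell_of_not_exceptional N hw hw'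
      (by linarith) (by linarith) (by linarith) h2
    refine ⟨i, hi, j, hj, T, hT, _, hzT, hc, ?_⟩
    have hlen := M.prod_len_nonneg N hM hN hc
    obtain ⟨-, -, c1, c2, c3, c4⟩ := hc
    simp only at c1 c2 c3 c4
    -- Here `s = H' - c`: the top of the L is at the height of the second coordinate, hence on step
    -- `l'`, and the point lies on the second leg.
    obtain rfl : j = l' := le_antisymm
      (Monotone.index_le mN c3 (t := N.height l' w' + u') (by linarith) (by linarith))
      (Monotone.index_le mN (s := N.height l' w' + u') (by linarith) (by linarith) c4)
    have hil : i ≤ l := Monotone.index_le mM c1 hlt.le (by linarith)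
    have htop : N.topPt j (w, w', N.height (N.k + 1) w' - N.height j w' - u') =
        N.chart j (w', u') := by
      rw [topPt_apply]; congr 2; ring
    obtain ⟨r, rfl⟩ := Nat.exists_eq_add_of_le hil
    rcases r with _ | r
    · have := (M.prod N i j).mem_of_lt hlen (l := j + 1)
        (u := M.height i w + u - (N.height (N.k + 1) w' - N.height j w' - u'))
        (show j + 1 ≤ j + 1 + (M.k - i) by omega) (by simp only [add_zero] at hlt; linarith) (by
          change _ < M.prodLen N i j (j + 1) (w, w', _)
          rw [M.prodLen_corner N]
          simp only [add_zero] at aS hu1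
          linarith)
      rw [M.prod_chart_corner N, htop] at this
      have hchart : M.chart (i + 0) (w, u) = M.chart i (w,
          N.height (N.k + 1) w' - N.height j w' - u' - M.height i w +
            (M.height i w + u - (N.height (N.k + 1) w' - N.height j w' - u'))) := by
        rw [add_zero]; congr 2; ring
      rw [pairChart_apply, hchart]
      exact this
    · have := (M.prod N i j).mem_of_lt hlen (l := j + 1 + (r + 1)) (u := u)
        (show j + 1 + (r + 1) ≤ j + 1 + (M.k - i) by omega) hu0 (by
          change _ < M.prodLen N i j (j + 1 + (r + 1)) (w, w', _)
          rw [M.prodLen_of_gt N]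
          exact hu1)
      rw [M.prod_chart_of_gt N, htop] at this
      exact this
  · obtain ⟨i, hi, j, hj, hc, T, hT, hzT⟩ := M.exists_cell_of_not_exceptional N hw hw'
      (by linarith) (by linarith) (by linarith) h1
    refine ⟨i, hi, j, hj, T, hT, _, hzT, hc, ?_⟩
    have hlen := M.prod_len_nonneg N hM hN hc
    obtain ⟨-, -, c1, c2, c3, c4⟩ := hc
    simp only at c1 c2 c3 c4
    -- Here `s = a`: the L starts at the height of the first coordinate, hence on step `l`, and the
    -- point lies on the first leg.
    obtain rfl : i = l := le_antisymm
      (Monotone.index_le mM c1 (t := M.height l w + u) (by linarith) (by linarith))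
      (Monotone.index_le mM (s := M.height l w + u) (by linarith) (by linarith) c2)
    have hjl : l' ≤ j := Monotone.index_le mN (s := N.height l' w' + u') (by linarith)
      (by linarith) c4
    have := (M.prod N i j).mem_of_lt hlen (l := l') (u := u')
      (show l' ≤ j + 1 + (M.k - i) by omega) hu0' (by
        change _ < M.prodLen N i j l' (w, w', _)
        rcases hjl.lt_or_eq with h | rfl
        · rw [M.prodLen_of_lt N h]; exact hu1'
        · rw [M.prodLen_top N]; linarith)
    rw [M.prod_chart_of_le N hjl, startPt_apply, add_sub_cancel_left] at this
    exact this

/-- Up to a negligible set, the product chains with parameters in the families `C` cover the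
product of the sets covered by the factor chains. -/
theorem negligible_uncovered {n n' : ℕ} (b : AffineBasis (Fin (n + 1)) ℝ E)
    (b' : AffineBasis (Fin (n' + 1)) ℝ E') (hM : ∀ z ∈ openSimplex b, ∀ l, 0 ≤ M.len l z)
    (hN : ∀ z ∈ openSimplex b', ∀ l, 0 ≤ N.len l z) {C : ℕ → ℕ → Set (Set (E × E' × ℝ))}
    (hC : ∀ i ≤ M.k, ∀ j ≤ N.k,
      Negligible (M.cell N (openSimplex b) (openSimplex b') i j \ ⋃₀ C i j))
    {X : Set (ι → ℝ)} {Y : Set (κ → ℝ)}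
    (hX : ∀ x ∈ X, ∃ l ≤ M.k, ∃ z u, (∀ j, 0 ≤ b.coord j z) ∧ 0 ≤ u ∧ u ≤ M.len l z ∧
      x = M.chart l (z, u))
    (hY : ∀ y ∈ Y, ∃ l ≤ N.k, ∃ z u, (∀ j, 0 ≤ b'.coord j z) ∧ 0 ≤ u ∧ u ≤ N.len l z ∧
      y = N.chart l (z, u)) :
    Negligible (prodSet X Y \ {p | ∃ i ≤ M.k, ∃ j ≤ N.k, ∃ T ∈ C i j, ∃ z ∈ T,
      (M.prod N i j).Mem z p}) := by
  set W := M.exceptional N (openSimplex b) (openSimplex b') C with hW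
  have hWn : Negligible W := M.negligible_exceptional N hC
  let p₁ : (E × ℝ) × (E' × ℝ) →ᵃ[ℝ] E × ℝ := AffineMap.fst
  let p₂ : (E × ℝ) × (E' × ℝ) →ᵃ[ℝ] E' × ℝ := AffineMap.snd
  let diag : ℕ → ℕ → (E × ℝ) × (E' × ℝ) →ᵃ[ℝ] ℝ := fun l l' =>
    (N.height (N.k + 1) - N.height l').comp (AffineMap.fst.comp p₂) - AffineMap.snd.comp p₂ -
      ((M.height l).comp (AffineMap.fst.comp p₁) + AffineMap.snd.comp p₁)
  -- The points to avoid for a pair of steps: those on the boundary of either step, those at a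
  -- corner of an L, and those where a candidate parameter is exceptional. Exceptional parameters
  -- pull back to a negligible set because the candidate maps are surjective and affine.
  let bad : ℕ → ℕ → Set ((E × ℝ) × (E' × ℝ)) := fun l l' =>
    p₁ ⁻¹' (M.degenerate b l) ∪
      (p₂ ⁻¹' (N.degenerate b' l') ∪
        ({p | diag l l' p = 0} ∪
          (M.lowerParam (E' := E') l ⁻¹' W ∪ N.upperParam l' ⁻¹' W)))
  have hbad : ∀ l l', Negligible (bad l l') := by
    intro l l'
    refine ((M.negligible_degenerate b l).preimage fun p => ⟨(p, 0), rfl⟩).union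
      (((N.negligible_degenerate b' l').preimage fun p => ⟨(0, p), rfl⟩).union
        (Negligible.union ?_ ((hWn.preimage (M.lowerParam_surjective (E' := E') l)).union
          (hWn.preimage (N.upperParam_surjective l')))))
    have hx : diag l l' ((0, N.height (N.k + 1) 0 - N.height l' 0 - M.height l 0 - 1), (0, 0)) =
        N.height (N.k + 1) 0 - N.height l' 0 - 0 -
          (M.height l 0 + (N.height (N.k + 1) 0 - N.height l' 0 - M.height l 0 - 1)) := rfl
    exact Negligible.zeros (diag l l') (by rw [hx]; ring_nf; exact one_ne_zero)
  refine (Negligible.iUnion fun l : Fin (M.k + 1) => Negligible.iUnion fun l' : Fin (N.k + 1) =>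
    (hbad l l').image (M.pairChart_injective N l l')).mono ?_
  rintro p ⟨⟨hpX, hpY⟩, hp⟩
  obtain ⟨l, hl, z, u, hz, hu0, hu1, hx⟩ := hX _ hpX
  obtain ⟨l', hl', z', u', hz', hu0', hu1', hy⟩ := hY _ hpY
  have hpe : p = M.pairChart N l l' ((z, u), (z', u')) := by
    rw [pairChart_apply, ← hx, ← hy]
    exact (Sum.elim_comp_inl_inr p).symm
  simp only [Set.mem_iUnion]
  refine ⟨⟨l, by omega⟩, ⟨l', by omega⟩, ((z, u), (z', u')), ?_, hpe.symm⟩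
  by_contra hnb
  simp only [bad, Set.mem_union, not_or] at hnb
  obtain ⟨n1, n2, n3, n4, n5⟩ := hnb
  obtain ⟨q1, q2, q3⟩ := M.lt_of_not_degenerate n1 hz hu0 hu1
  obtain ⟨q1', q2', q3'⟩ := N.lt_of_not_degenerate n2 hz' hu0' hu1'
  obtain ⟨i, hi, j, hj, T, hT, y, hyT, -, hy⟩ := M.exists_prod_mem N hM hN (C := C) hl hl' q1 q1'
    q2 q3 q2' q3' (fun e => n3 (by
      change N.height (N.k + 1) z' - N.height l' z' - u' - (M.height l z + u) = 0
      rw [e, sub_self])) n4 n5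
  exact hp ⟨i, hi, j, hj, T, hT, y, hyT, hpe ▸ hy⟩

end ChainBundle

end Cells

end GeomSCD

namespace GeomSCD

/-! ### Products of polytopes and additivity of the rank -/

section PolytopeProduct

variable {ι κ : Type*} [Fintype ι] [DecidableEq ι] [Fintype κ] [DecidableEq κ]

theorem prodSet_eq_image (P : Set (ι → ℝ)) (Q : Set (κ → ℝ)) :
    prodSet P Q = (LinearEquiv.sumArrowLequivProdArrow ι κ ℝ ℝ).symm.toLinearMap '' (P ×ˢ Q) := by
  ext p
  constructor
  · intro hp
    exact ⟨(fun i => p (Sum.inl i), fun j => p (Sum.inr j)), hp, Sum.elim_comp_inl_inr p⟩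
  · rintro ⟨⟨x, y⟩, hxy, rfl⟩
    exact hxy

theorem IsPolytope.isCompact {P : Set (ι → ℝ)} (hP : IsPolytope P) : IsCompact P := by
  obtain ⟨-, C, rfl⟩ := hP
  exact C.isCompact_biUnion fun V _ => V.finite_toSet.isCompact_convexHull (𝕜 := ℝ)

theorem IsPolytope.prodSet {P : Set (ι → ℝ)} {Q : Set (κ → ℝ)} (hP : IsPolytope P)
    (hQ : IsPolytope Q) : IsPolytope (prodSet P Q) := by
  classical
  obtain ⟨⟨x, hx⟩, C, hC⟩ := hP
  obtain ⟨⟨y, hy⟩, D, hD⟩ := hQ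
  let e := (LinearEquiv.sumArrowLequivProdArrow ι κ ℝ ℝ).symm.toLinearMap
  refine ⟨⟨Sum.elim x y, hx, hy⟩, (C ×ˢ D).image fun VW => (VW.1 ×ˢ VW.2).image e, ?_⟩
  rw [prodSet_eq_image]
  have key : ∀ V W : Finset _, convexHull ℝ (((V ×ˢ W).image e : Finset (ι ⊕ κ → ℝ)) :
      Set (ι ⊕ κ → ℝ)) = e '' (convexHull ℝ (V : Set (ι → ℝ)) ×ˢ
        convexHull ℝ (W : Set (κ → ℝ))) := by
    intro V W
    rw [Finset.coe_image, Finset.coe_product, ← e.image_convexHull, convexHull_prod]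
  ext p
  simp only [Finset.mem_image, Set.mem_iUnion, exists_prop]
  constructor
  · rintro ⟨⟨u, v⟩, ⟨hu, hv⟩, rfl⟩
    rw [hC] at hu
    rw [hD] at hv
    simp only [Set.mem_iUnion] at hu hv
    obtain ⟨V, hV, hu⟩ := hu
    obtain ⟨W, hW, hv⟩ := hv
    refine ⟨_, ⟨(V, W), Finset.mem_product.2 ⟨hV, hW⟩, rfl⟩, ?_⟩
    rw [key]
    exact ⟨(u, v), ⟨hu, hv⟩, rfl⟩
  · rintro ⟨_, ⟨⟨V, W⟩, hVW, rfl⟩, hp⟩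
    obtain ⟨hV, hW⟩ := Finset.mem_product.1 hVW
    rw [key] at hp
    obtain ⟨⟨u, v⟩, ⟨hu, hv⟩, rfl⟩ := hp
    refine ⟨(u, v), ⟨?_, ?_⟩, rfl⟩
    · rw [hC]; exact Set.mem_biUnion hV hu
    · rw [hD]; exact Set.mem_biUnion hW hv

theorem interior_prodSet_nonempty {P : Set (ι → ℝ)} {Q : Set (κ → ℝ)}
    (hP : (interior P).Nonempty) (hQ : (interior Q).Nonempty) :
    (interior (prodSet P Q)).Nonempty := by
  obtain ⟨x, hx⟩ := hP
  obtain ⟨y, hy⟩ := hQ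
  refine ⟨Sum.elim x y, interior_maximal (t := prodSet (interior P) (interior Q)) ?_ ?_ ⟨hx, hy⟩⟩
  · rintro p ⟨h1, h2⟩
    exact ⟨interior_subset h1, interior_subset h2⟩
  · exact (isOpen_interior.preimage (by fun_prop)).inter (isOpen_interior.preimage (by fun_prop))

theorem IsFullDimPolytope.prodSet {P : Set (ι → ℝ)} {Q : Set (κ → ℝ)} (hP : IsFullDimPolytope P)
    (hQ : IsFullDimPolytope Q) : IsFullDimPolytope (prodSet P Q) :=
  ⟨hP.1.prodSet hQ.1, interior_prodSet_nonempty hP.2 hQ.2⟩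

open Pointwise in
theorem rk_image_prodSet (P : Set (ι → ℝ)) (Q : Set (κ → ℝ)) :
    rk '' prodSet P Q = rk '' P + rk '' Q := by
  ext r
  constructor
  · rintro ⟨p, ⟨h1, h2⟩, rfl⟩
    exact ⟨_, ⟨_, h1, rfl⟩, _, ⟨_, h2, rfl⟩, by
      rw [← Sum.elim_comp_inl_inr p, rk_sumElim]; rfl⟩
  · rintro ⟨_, ⟨x, hx, rfl⟩, _, ⟨y, hy, rfl⟩, rfl⟩
    exact ⟨Sum.elim x y, ⟨hx, hy⟩, rk_sumElim x y⟩

/-- The ranks on the product form a sumset; compactness gives the bounds under which supremum and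
infimum are additive. -/
theorem polytopeRank_prodSet {P : Set (ι → ℝ)} {Q : Set (κ → ℝ)} (hP : IsPolytope P)
    (hQ : IsPolytope Q) : polytopeRank (prodSet P Q) = polytopeRank P + polytopeRank Q := by
  have hc : Continuous (rk : (ι → ℝ) → ℝ) := by unfold rk; fun_prop
  have hc' : Continuous (rk : (κ → ℝ) → ℝ) := by unfold rk; fun_prop
  have h1 := hP.isCompact.image hc
  have h2 := hQ.isCompact.image hc'
  rw [polytopeRank, rk_image_prodSet,
    csSup_add (hP.1.image _) h1.bddAbove (hQ.1.image _) h2.bddAbove,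
    csInf_add (hP.1.image _) h1.bddBelow (hQ.1.image _) h2.bddBelow, polytopeRank, polytopeRank]
  ring

end PolytopeProduct

/-! ### Snakes in the product of two snakes -/

section ProductSnakes

variable {ι κ : Type*} [Fintype ι] [DecidableEq ι] [Fintype κ] [DecidableEq κ]
variable {E : Type*} [NormedAddCommGroup E] [NormedSpace ℝ E] [FiniteDimensional ℝ E]
variable {E' : Type*} [NormedAddCommGroup E'] [NormedSpace ℝ E'] [FiniteDimensional ℝ E']

theorem exists_bound_on_openSimplex {σ : Type*} [Fintype σ] (b : AffineBasis σ ℝ E)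
    (f : E →ᵃ[ℝ] ℝ) : ∃ c, ∀ x ∈ openSimplex b, |f x| ≤ c := by
  obtain ⟨c, hc⟩ := ((Set.finite_range b).isCompact_convexHull (𝕜 := ℝ)).exists_bound_of_continuousOn
    f.continuous_of_finiteDimensional.continuousOn
  refine ⟨c, fun x hx => hc x ?_⟩
  rw [openSimplex, ← b.interior_convexHull] at hx
  exact interior_subset hx

theorem isBounded_openSimplex {σ : Type*} [Fintype σ] (b : AffineBasis σ ℝ E) :
    Bornology.IsBounded (openSimplex b) := by
  rw [openSimplex, ← b.interior_convexHull]
  exact (((Set.finite_range b).isCompact_convexHull (𝕜 := ℝ)).isBounded).subset interior_subset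

namespace ChainBundle

variable (M : ChainBundle ι E) (N : ChainBundle κ E') {n n' : ℕ}
  (b : AffineBasis (Fin (n + 1)) ℝ E) (b' : AffineBasis (Fin (n' + 1)) ℝ E')

theorem isBounded_cell (i j : ℕ) :
    Bornology.IsBounded (M.cell N (openSimplex b) (openSimplex b') i j) := by
  obtain ⟨c, hc⟩ := exists_bound_on_openSimplex b (M.height i)
  obtain ⟨c', hc'⟩ := exists_bound_on_openSimplex b (M.height (i + 1))
  refine ((isBounded_openSimplex b).prod ((isBounded_openSimplex b').prod
    (Metric.isBounded_Icc (-c) c'))).subset ?_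
  rintro ⟨w, w', s⟩ ⟨h1, h2, h3, h4, -, -⟩
  refine ⟨h1, h2, ?_, ?_⟩
  · exact (neg_le_of_abs_le (hc w h1)).trans h3.le
  · exact h4.le.trans (le_of_abs_le (hc' w h1))

theorem dissectable_cell {d : ℕ} (hd : Module.finrank ℝ (E × E' × ℝ) = d) (i j : ℕ) :
    Dissectable (Fin (d + 1)) (M.cell N (openSimplex b) (openSimplex b') i j) := by
  let L : List (E × E' × ℝ →ᵃ[ℝ] ℝ) :=
    (List.ofFn fun m => (b.coord m).comp AffineMap.fst) ++
      ((List.ofFn fun m => (b'.coord m).comp (AffineMap.fst.comp AffineMap.snd)) ++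
        [M.startOffset i, -M.startOffset (i + 1), N.topOffset j, -N.topOffset (j + 1)])
  have hL : M.cell N (openSimplex b) (openSimplex b') i j = {z | ∀ f ∈ L, 0 < f z} := by
    ext ⟨w, w', s⟩
    have e1 : (w, w', s) ∈ M.cell N (openSimplex b) (openSimplex b') i j ↔
        (∀ m, 0 < b.coord m w) ∧ (∀ m, 0 < b'.coord m w') ∧ M.height i w < s ∧
        s < M.height (i + 1) w ∧ N.height j w' < N.height (N.k + 1) w' - s ∧
        N.height (N.k + 1) w' - s < N.height (j + 1) w' := Iff.rfl
    rw [e1]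
    simp only [L, Set.mem_ofPred_eq, List.forall_mem_append, List.forall_mem_ofFn_iff,
      List.forall_mem_cons, AffineMap.coe_comp, Function.comp_apply, AffineMap.coe_neg,
      Pi.neg_apply, startOffset_apply, topOffset_apply, AffineMap.coe_fst, AffineMap.coe_snd,
      sub_pos, neg_sub, List.not_mem_nil, false_imp_iff, implies_true, and_true]
  have hb := M.isBounded_cell N b b' i j
  rw [hL] at hb ⊢
  exact dissectable_of_isBounded hd L hb

variable {b b'}

/-- The snakes in the product of two families of chains. -/
theorem exists_prod_snakes (hM : ∀ z ∈ openSimplex b, ∀ l, 0 ≤ M.len l z)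
    (hN : ∀ z ∈ openSimplex b', ∀ l, 0 ≤ N.len l z) (sM : M.Separates (openSimplex b))
    (sN : N.Separates (openSimplex b')) (wM : M.WeakHyperplane (openSimplex b))
    (wN : N.WeakHyperplane (openSimplex b')) (dM : Module.finrank ℝ E + 1 = Fintype.card ι)
    (dN : Module.finrank ℝ E' + 1 = Fintype.card κ) {r r' : ℝ} (rM : M.Balanced r)
    (rN : N.Balanced r') {Z : Set (ι ⊕ κ → ℝ)} (hZ : polytopeRank Z = r + r')
    {X : Set (ι → ℝ)} {Y : Set (κ → ℝ)}
    (hX : ∀ x ∈ X, ∃ l ≤ M.k, ∃ z u, (∀ j, 0 ≤ b.coord j z) ∧ 0 ≤ u ∧ u ≤ M.len l z ∧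
      x = M.chart l (z, u))
    (hY : ∀ y ∈ Y, ∃ l ≤ N.k, ∃ z u, (∀ j, 0 ≤ b'.coord j z) ∧ 0 ≤ u ∧ u ≤ N.len l z ∧
      y = N.chart l (z, u)) :
    ∃ (c : ℕ) (S : Fin c → Snake (ι ⊕ κ)),
      (∀ a, (S a).IsSymmetric Z ∧ (S a).WeakHyperplane ∧ (interior (S a).carrier).Nonempty) ∧
      (∀ a, ∀ p ∈ (S a).carrier, (∃ w ∈ openSimplex b, M.Mem w (p ∘ Sum.inl)) ∧
        ∃ w' ∈ openSimplex b', N.Mem w' (p ∘ Sum.inr)) ∧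
      (∀ a a', a ≠ a' → Disjoint (S a).carrier (S a').carrier) ∧
      Negligible (prodSet X Y \ ⋃ a, (S a).carrier) := by
  have hdim : Module.finrank ℝ (E × E' × ℝ) + 1 = Fintype.card (ι ⊕ κ) := by
    simp only [Module.finrank_prod, Module.finrank_self, Fintype.card_sum]
    omega
  choose C hfin hC hdis hneg using fun i j => M.dissectable_cell N b b' rfl i j
  have hsnake : ∀ (i : Fin (M.k + 1)) (j : Fin (N.k + 1)) (T : C i j),
      ∃ F : Snake (ι ⊕ κ), F.carrier = {p | ∃ z ∈ T.1, (M.prod N i j).Mem z p} ∧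
        F.IsSymmetric Z ∧ F.WeakHyperplane ∧ (interior F.carrier).Nonempty := by
    rintro i j ⟨T, hT⟩
    obtain ⟨⟨β, rfl⟩, hsub⟩ := hC i j T hT
    have hi : i.1 ≤ M.k := by omega
    have hj : j.1 ≤ N.k := by omega
    have hlen : ∀ z ∈ openSimplex β, ∀ l, 0 ≤ (M.prod N i j).len l z := fun z hz l =>
      M.prod_len_nonneg N hM hN (hsub hz) l
    have hsep : (M.prod N i j).Separates (openSimplex β) := fun z hz z' hz' p hp hp' =>
      M.prod_separates N hM hN sM sN hi hj hi hj (hsub hz) (hsub hz') hp hp'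
    refine ⟨(M.prod N i j).toSnake β hlen hsep, carrier_toSnake _ _ _ _, ?_, ?_, ?_⟩
    · refine isSymmetric_toSnake _ _ _ _ ?_
      rw [hZ]
      exact M.prod_balanced N hi rM rN
    · exact weakHyperplane_toSnake _ _ _ _ (M.prod_weakHyperplane N hi hj wM wN fun z hz =>
        ⟨(hsub hz).1, (hsub hz).2.1⟩)
    · rw [carrier_toSnake]
      refine interior_nonempty _ hdim (isOpen_openSimplex β) (openSimplex_nonempty β) hlen
        -- Step `j`, the last climb to the corner, has positive length throughout the cell because
        -- the cell inequalities are strict.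
        (l := j) (show j.1 ≤ j.1 + 1 + (M.k - i.1) by omega) ?_
      rintro ⟨w, w', s⟩ hz
      obtain ⟨-, -, -, -, h5, -⟩ := hsub hz
      change 0 < M.prodLen N i j j (w, w', s)
      rw [M.prodLen_top N]
      exact sub_pos.2 h5
  choose F hFc hF using hsnake
  let A := Σ (i : Fin (M.k + 1)) (j : Fin (N.k + 1)), C i j
  have : ∀ i j, Finite (C i j) := fun i j => hfin i j
  let e := Finite.equivFin A
  let G : A → Snake (ι ⊕ κ) := fun a => F a.1 a.2.1 a.2.2
  have hGc : ∀ a, (G a).carrier = {p | ∃ z ∈ a.2.2.1, (M.prod N a.1 a.2.1).Mem z p} :=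
    fun a => hFc _ _ _
  refine ⟨Nat.card A, fun a => G (e.symm a), fun a => hF _ _ _, ?_, ?_, ?_⟩
  · intro a p hp
    rw [hGc] at hp
    obtain ⟨⟨w, w', s⟩, hz, hm⟩ := hp
    rw [← Sum.elim_comp_inl_inr p] at hm
    have hcell := (hC _ _ _ (e.symm a).2.2.2).2 hz
    obtain ⟨h1, h2, -⟩ := M.mem_of_prod_mem N hM hN (by omega) (by omega) hcell hm
    exact ⟨⟨w, hcell.1, h1⟩, ⟨w', hcell.2.1, h2⟩⟩
  · suffices key : ∀ α α', α ≠ α' → Disjoint (G α).carrier (G α').carrier from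
      fun a a' hne => key _ _ fun h => hne (e.symm.injective h)
    intro α α' hne'
    rw [Set.disjoint_left]
    intro p hp hp'
    rw [hGc] at hp hp'
    obtain ⟨i, j, T, hT⟩ := α
    obtain ⟨i', j', T', hT'⟩ := α'
    obtain ⟨z, hz, hm⟩ := hp
    obtain ⟨z', hz', hm'⟩ := hp'
    have hc := (hC _ _ _ hT).2 hz
    have hc' := (hC _ _ _ hT').2 hz'
    -- A common point forces equal parameters, hence equal cells, hence equal simplices of the
    -- dissection of that cell.
    obtain rfl := M.prod_separates N hM hN sM sN (by omega) (by omega) (by omega) (by omega)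
      hc hc' hm hm'
    obtain ⟨e1, e2⟩ := M.cell_index_unique N hM hN hc hc'
    obtain rfl := Fin.ext e1
    obtain rfl := Fin.ext e2
    obtain rfl : T = T' := by
      by_contra h
      exact Set.disjoint_left.1 (hdis i j hT hT' h) hz hz'
    exact hne' rfl
  · refine (M.negligible_uncovered N b b' hM hN (C := C) (fun i _ j _ => hneg i j) hX hY).mono ?_
    rintro p ⟨hp, hn⟩
    refine ⟨hp, ?_⟩
    rintro ⟨i, hi, j, hj, T, hT, z, hz, hm⟩
    apply hn
    rw [Set.mem_iUnion]
    refine ⟨e ⟨⟨i, by omega⟩, ⟨j, by omega⟩, ⟨T, hT⟩⟩, ?_⟩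
    change p ∈ (G (e.symm (e _))).carrier
    rw [Equiv.symm_apply_apply, hGc]
    exact ⟨z, hz, hm⟩

end ChainBundle

end ProductSnakes

/-! ### Assembly over all pairs of snakes -/

theorem exists_bundle {ι : Type*} [Fintype ι] [DecidableEq ι] (S : SwipeSeq ι) :
    ∃ b : AffineBasis (Fin (S.d + 1)) ℝ (Fin S.d → ℝ), ∃ M : ChainBundle ι (Fin S.d → ℝ),
      Realizes S M b ∧ ∀ z ∈ openSimplex b, ∀ l, 0 ≤ M.len l z := by
  obtain ⟨b⟩ := AffineBasis.exists_affineBasis_of_finiteDimensional (ι := Fin (S.d + 1))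
    (k := ℝ) (P := Fin S.d → ℝ) (by simp)
  exact ⟨b, exists_realizes S b⟩

/-- Points of a product snake project into the two factor snakes, so snakes from different pairs are
disjoint because the factors are. The uncovered set lies over the uncovered sets of `P` and `Q`,
together with the remainders for the finitely many pairs. -/
theorem HasWeakAsymptoticDecomposition.prodSet {ι κ : Type*} [Fintype ι] [DecidableEq ι]
    [Fintype κ] [DecidableEq κ] {P : Set (ι → ℝ)} {Q : Set (κ → ℝ)} (hP : IsPolytope P)
    (hQ : IsPolytope Q) (hPd : HasWeakAsymptoticDecomposition P)
    (hQd : HasWeakAsymptoticDecomposition Q) :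
    HasWeakAsymptoticDecomposition (prodSet P Q) := by
  obtain ⟨m, F, hF, hFw⟩ := hPd
  obtain ⟨n, G, hG, hGw⟩ := hQd
  choose b M R hM using fun a => exists_bundle (F a).seq
  choose b' N R' hN using fun a => exists_bundle (G a).seq
  have hpair := fun a c => (M a).exists_prod_snakes (N c) (hM a) (hN c)
    (separates_of_realizes (R a)) (separates_of_realizes (R' c))
    (weakHyperplane_of_realizes (R a) (hFw a)) (weakHyperplane_of_realizes (R' c) (hGw c))
    (finrank_add_one_eq_card (R a) (hF.fullDim a)) (finrank_add_one_eq_card (R' c) (hG.fullDim c))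
    (balanced_of_realizes (R a) (hF.symmetric a)) (balanced_of_realizes (R' c) (hG.symmetric c))
    (polytopeRank_prodSet hP hQ) (fun x => exists_chart_of_mem_snake (R a) (x := x))
    (fun y => exists_chart_of_mem_snake (R' c) (x := y))
  choose k S hS hmem hdis hneg using hpair
  let e := Finite.equivFin (Σ (a : Fin m) (c : Fin n), Fin (k a c))
  have hfac : ∀ a c i, ∀ p ∈ (S a c i).carrier,
      p ∘ Sum.inl ∈ (F a).carrier ∧ p ∘ Sum.inr ∈ (G c).carrier := by
    intro a c i p hp
    obtain ⟨⟨w, hw, h1⟩, w', hw', h2⟩ := hmem a c i p hp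
    exact ⟨mem_snake_carrier (R a) hw h1, mem_snake_carrier (R' c) hw' h2⟩
  refine ⟨_, fun α => S (e.symm α).1 (e.symm α).2.1 (e.symm α).2.2,
    ⟨fun α p hp => ?_, fun α => (hS _ _ _).2.2, fun α => (hS _ _ _).1, fun α α' hne => ?_, ?_⟩,
    fun α => (hS _ _ _).2.1⟩
  · obtain ⟨h1, h2⟩ := hfac _ _ _ p hp
    exact ⟨hF.subset _ h1, hG.subset _ h2⟩
  · have hne' : e.symm α ≠ e.symm α' := fun h => hne (e.symm.injective h)
    revert hne'
    generalize e.symm α = β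
    generalize e.symm α' = β'
    intro hne'
    obtain ⟨a, c, i⟩ := β
    obtain ⟨a', c', i'⟩ := β'
    by_cases ha : a = a'
    · subst ha
      by_cases hc : c = c'
      · subst hc
        exact hdis a c i i' fun h => hne' (by rw [h])
      · exact Set.disjoint_left.2 fun p hp hp' =>
          Set.disjoint_left.1 (hG.disjoint c c' hc) (hfac _ _ _ p hp).2 (hfac _ _ _ p hp').2
    · exact Set.disjoint_left.2 fun p hp hp' =>
        Set.disjoint_left.1 (hF.disjoint a a' ha) (hfac _ _ _ p hp).1 (hfac _ _ _ p hp').1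
  · have h1 : Negligible (P \ ⋃ a, (F a).carrier) := hF.codim
    have h2 : Negligible (Q \ ⋃ c, (G c).carrier) := hG.codim
    let l : (ι ⊕ κ → ℝ) →ᵃ[ℝ] (ι → ℝ) := (LinearMap.funLeft ℝ ℝ Sum.inl).toAffineMap
    let r : (ι ⊕ κ → ℝ) →ᵃ[ℝ] (κ → ℝ) := (LinearMap.funLeft ℝ ℝ Sum.inr).toAffineMap
    have hl : Function.Surjective l := fun x => ⟨Sum.elim x 0, rfl⟩
    have hr : Function.Surjective r := fun y => ⟨Sum.elim 0 y, rfl⟩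
    refine Negligible.mono ((h1.preimage hl).union ((h2.preimage hr).union
      (Negligible.iUnion fun a => Negligible.iUnion fun c => hneg a c))) ?_
    rintro p ⟨⟨hp1, hp2⟩, hn⟩
    by_cases hx : l p ∈ ⋃ a, (F a).carrier
    · by_cases hy : r p ∈ ⋃ c, (G c).carrier
      · obtain ⟨a, ha⟩ := Set.mem_iUnion.1 hx
        obtain ⟨c, hc⟩ := Set.mem_iUnion.1 hy
        refine Or.inr (Or.inr (Set.mem_iUnion.2 ⟨a, Set.mem_iUnion.2 ⟨c, ⟨ha, hc⟩, fun h => ?_⟩⟩))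
        obtain ⟨i, hi⟩ := Set.mem_iUnion.1 h
        have key : ∀ β : Σ (a : Fin m) (c : Fin n), Fin (k a c), β = ⟨a, c, i⟩ →
            p ∈ (S β.1 β.2.1 β.2.2).carrier := by
          rintro _ rfl
          exact hi
        exact hn (Set.mem_iUnion.2 ⟨e ⟨a, c, i⟩, key _ (e.symm_apply_apply _)⟩)
      · exact Or.inr (Or.inl ⟨hp2, hy⟩)
    · exact Or.inl ⟨hp1, hx⟩

end GeomSCD

theorem theorem6p7 {ι κ : Type*} [Fintype ι] [DecidableEq ι] [Fintype κ] [DecidableEq κ]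
    (P : Set (ι → ℝ)) (Q : Set (κ → ℝ))
    (hP : GeomSCD.IsFullDimPolytope P) (hQ : GeomSCD.IsFullDimPolytope Q)
    (hPdec : GeomSCD.HasWeakAsymptoticDecomposition P)
    (hQdec : GeomSCD.HasWeakAsymptoticDecomposition Q) :
    GeomSCD.IsFullDimPolytope (GeomSCD.prodSet P Q) ∧
      GeomSCD.HasWeakAsymptoticDecomposition (GeomSCD.prodSet P Q) :=
  ⟨hP.prodSet hQ, hPdec.prodSet hP.1 hQ.1 hQdec⟩
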